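/- All rings are commutative with unit. A $\lambda$-ring is a ring $R$ with maps $\lambda^n:R\to R$ $(n\ge 0)$ such that for all $x,y\in R$: $\lambda^0(x)=1$; $\lambda^1(x)=x$; $\lambda^n(1)=0$ for $n\ge 2$; $\lambda^n(x+y)=\sum_{i+j=n}\lambda^i(x)\lambda^j(y)$; $\lambda^n(xy)=P_n(\lambda^1(x),\dots,\lambda^n(x);\lambda^1(y),\dots,\lambda^n(y))$; $\lambda^n(\lambda^m(x))=P_{n,m}(\lambda^1(x),\dots,\lambda^{nm}(x))$. Here $P_n$ and $P_{n,m}$ are the integral polynomials such that, with $s_i$ and $\sigma_j$ denoting the elementary symmetric polynomials in the $x$'s and the $y$'s, $P_n(s_1,\dots,s_n;\sigma_1,\dots,\sigma_n)$ is the coefficient of $t^n$ in $\prod_{i,j=1}^n(1+x_iy_jt)$ and $P_{n,m}(s_1,\dots,s_{nm})$ is the coefficient of $t^n$ in $\prod_{1\le i_1<\dots<i_m\le nm}(1+x_{i_1}\cdots x_{i_m}t)$. Morphisms of $\lambda$-rings are ring homomorphisms commuting with all $\lambda^n$. Let $F_1$ be the ring $\mathbb Z$ with its canonical $\lambda$-structure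 $\lambda^n(a)=\binom an$. Let $\mathbb Z[x]$ carry the $\lambda$-structure with $\lambda^n(x^i)=0$ for all $n>1$, $i\ge 0$, and regard it as a $\lambda$-ring over $F_1$ via $x\mapsto 0$. Let $F_1\text{-mod}^\lambda$ be the category of abelian group objects in the category of $\lambda$-rings over $F_1$; write $\mathbb Z\triangleright P$ for the $\lambda$-ring over $F_1$ underlying an object $P$. An object $P$ of a category with zero object is simple if every morphism out of $P$ is a monomorphism or zero, and finite if $\operatorname{End}(P)$ is finite. For $P$ in $F_1\text{-mod}^\lambda$ put $n(P)=|\operatorname{Hom}(\mathbb Z[x],\mathbb Z\triangleright P)|$, the number of morphisms of $\lambda$-rings over $F_1$; call $P$ non-degenerate if it is simple and finite and $1<n(P)<\infty$. The geometric zeta function is $$\zeta_g(s,F_1\text{-mod}^\lambda)=\prod_{P}\bigl(1-n(P)^{-s}\bigr)^{-1},$$ the product over the isomorphism classes of non-degenerate objects. **Corollary 4.5.** For every complex $s$ with $\operatorname{Re}s>1$ the product $\zeta_g(s,F_1\text{-mod}^\lambda)$ converges unconditionally, and $$\zeta_g(s,F_1\text{-mod}^\lambda)=\zeta(s),$$ where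 $\zeta$ is the Riemann zeta function. -/

import Mathlib

open CategoryTheory CategoryTheory.Limits

namespace FOne

section UniversalPolynomials

open MvPolynomial

/-- A symmetric polynomial in `N` variables over `B` is a polynomial in the elementary symmetric
polynomials. -/
theorem exists_aeval_esymm {B : Type*} [CommRing B] {N : ℕ} (F : MvPolynomial (Fin N) B)
    (hF : F.IsSymmetric) :
    ∃ G : MvPolynomial (Fin N) B, aeval (fun i : Fin N => esymm (Fin N) B (i + 1)) G = F := by
  obtain ⟨G, hG⟩ := esymmAlgHom_surjective (σ := Fin N) B (n := N) (by simp) ⟨F, hF⟩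
  exact ⟨G, by rw [← esymmAlgHom_apply, hG]⟩

theorem aeval_esymm_injective {B : Type*} [CommRing B] {N : ℕ} :
    Function.Injective (aeval (R := B) (fun i : Fin N => esymm (Fin N) B (i + 1))) := by
  intro p q h
  apply esymmAlgHom_injective (σ := Fin N) B (n := N) (by simp)
  apply Subtype.ext
  rw [esymmAlgHom_apply, esymmAlgHom_apply, h]

theorem ringHom_aeval {σ A A' F : Type*} [CommRing A] [CommRing A'] [FunLike F A A']
    [RingHomClass F A A'] (f : F) (z : σ → A) (P : MvPolynomial σ ℤ) :
    f (aeval z P) = aeval (fun i => f (z i)) P :=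
  comp_aeval_apply z (RingHomClass.toRingHom f).toIntAlgHom P

/-- Permuting the arguments of an elementary symmetric polynomial does not change its value. -/
theorem aeval_esymm_comp {ι A : Type*} [Fintype ι] [CommRing A] (z : ι → A) (e : Equiv.Perm ι)
    (n : ℕ) : aeval (z ∘ e) (esymm ι ℤ n) = aeval z (esymm ι ℤ n) := by
  rw [← aeval_rename, esymm_isSymmetric]

theorem exists_mulPoly (n : ℕ) : ∃ P : MvPolynomial (Fin n ⊕ Fin n) ℤ,
    aeval (Sum.elim
        (fun i : Fin n => rename Sum.inl (esymm (Fin n) ℤ (i + 1)))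
        (fun j : Fin n => rename Sum.inr (esymm (Fin n) ℤ (j + 1)))) P =
      aeval (fun p : Fin n × Fin n =>
          (X (Sum.inl p.1) * X (Sum.inr p.2) : MvPolynomial (Fin n ⊕ Fin n) ℤ))
        (esymm (Fin n × Fin n) ℤ n) := by
  let z : Fin n × Fin n → MvPolynomial (Fin n) (MvPolynomial (Fin n) ℤ) :=
    fun p => X p.1 * C (X p.2)
  let F : MvPolynomial (Fin n) (MvPolynomial (Fin n) ℤ) := aeval z (esymm (Fin n × Fin n) ℤ n)
  have hF : F.IsSymmetric := by
    intro e
    refine (ringHom_aeval _ z _).trans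
      (Eq.trans ?_ (aeval_esymm_comp z (e.prodCongr (Equiv.refl _)) n))
    congr 2
    ext p : 1
    simp [z]
  obtain ⟨G, hG⟩ := exists_aeval_esymm F hF
  have hGs : ∀ e : Equiv.Perm (Fin n), MvPolynomial.map (rename e).toRingHom G = G := by
    intro e
    apply aeval_esymm_injective
    have h1 : ∀ G : MvPolynomial (Fin n) (MvPolynomial (Fin n) ℤ),
        aeval (fun i : Fin n => esymm (Fin n) (MvPolynomial (Fin n) ℤ) (i + 1))
          (MvPolynomial.map (rename e).toRingHom G) =
        MvPolynomial.map (rename e).toRingHom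
          (aeval (fun i : Fin n => esymm (Fin n) (MvPolynomial (Fin n) ℤ) (i + 1)) G) := by
      intro G
      induction G using MvPolynomial.induction_on with
      | C a => simp
      | add p q hp hq => simp only [map_add, hp, hq]
      | mul_X p i hp => simp only [map_mul, hp, map_X, aeval_X, map_esymm]
    rw [h1, hG]
    refine (ringHom_aeval _ z _).trans
      (Eq.trans ?_ (aeval_esymm_comp z ((Equiv.refl _).prodCongr e) n))
    congr 2
    ext p : 1
    simp [z]
  let ev : MvPolynomial (Fin n) ℤ →ₐ[ℤ] MvPolynomial (Fin n) ℤ :=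
    aeval (fun i : Fin n => esymm (Fin n) ℤ (i + 1))
  obtain ⟨Q, hQ⟩ : ∃ Q, MvPolynomial.map ev.toRingHom Q = G := by
    have : G ∈ Set.range (MvPolynomial.map (σ := Fin n) ev.toRingHom) := by
      rw [mem_range_map_iff_coeffs_subset]
      intro c hc
      obtain ⟨d, -, rfl⟩ := mem_coeffs_iff.1 hc
      refine exists_aeval_esymm _ fun e => ?_
      conv_rhs => rw [← hGs e, coeff_map]
      rfl
    exact this
  refine ⟨(sumAlgEquiv ℤ (Fin n) (Fin n)).symm Q, ?_⟩
  obtain ⟨P, rfl⟩ := (sumAlgEquiv ℤ (Fin n) (Fin n)).surjective Q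
  rw [AlgEquiv.symm_apply_apply]
  apply (sumAlgEquiv ℤ (Fin n) (Fin n)).injective
  have hR : (sumAlgEquiv ℤ (Fin n) (Fin n)) (aeval (fun p : Fin n × Fin n =>
      (X (Sum.inl p.1) * X (Sum.inr p.2) : MvPolynomial (Fin n ⊕ Fin n) ℤ))
        (esymm (Fin n × Fin n) ℤ n)) = F := by
    refine (ringHom_aeval _ _ _).trans ?_
    congr 2
    ext p : 1
    simp [z]
  rw [hR, ← hG, ← hQ]
  clear hR hQ
  induction P using MvPolynomial.induction_on with
  | C a => simp
  | add p q hp hq => simp only [map_add, hp, hq]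
  | mul_X p i hp =>
    simp only [map_mul, hp]
    congr 1
    rcases i with i | i
    · simp [esymm, map_sum, map_prod]
    · simp [esymm, map_sum, map_prod, ev]

/-- The universal polynomial `P_n`: if `s_i` and `σ_j` denote the elementary symmetric polynomials
in `x_1, …, x_n` and in `y_1, …, y_n`, then `P_n(s_1, …, s_n; σ_1, …, σ_n)` is the coefficient of
`t ^ n` in `∏_{i, j} (1 + x_i y_j t)`, that is, the `n`-th elementary symmetric polynomial of the
products `x_i y_j`.  (As the `s_i`, `σ_j` are algebraically independent, this determines `P_n`.) -/
noncomputable def mulPoly (n : ℕ) : MvPolynomial (Fin n ⊕ Fin n) ℤ :=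
  Classical.choose (exists_mulPoly n)

theorem mulPoly_spec (n : ℕ) :
    aeval (Sum.elim
        (fun i : Fin n => rename Sum.inl (esymm (Fin n) ℤ (i + 1)))
        (fun j : Fin n => rename Sum.inr (esymm (Fin n) ℤ (j + 1)))) (mulPoly n) =
      aeval (fun p : Fin n × Fin n =>
          (X (Sum.inl p.1) * X (Sum.inr p.2) : MvPolynomial (Fin n ⊕ Fin n) ℤ))
        (esymm (Fin n × Fin n) ℤ n) :=
  Classical.choose_spec (exists_mulPoly n)

theorem exists_compPoly (n m : ℕ) : ∃ P : MvPolynomial (Fin (n * m)) ℤ,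
    aeval (fun i : Fin (n * m) => esymm (Fin (n * m)) ℤ (i + 1)) P =
      aeval (fun S : {S : Finset (Fin (n * m)) // S.card = m} =>
          (∏ i ∈ S.1, X i : MvPolynomial (Fin (n * m)) ℤ))
        (esymm {S : Finset (Fin (n * m)) // S.card = m} ℤ n) := by
  refine exists_aeval_esymm _ fun e => ?_
  let e' : Equiv.Perm {S : Finset (Fin (n * m)) // S.card = m} :=
    e.finsetCongr.subtypeEquiv (fun S => by simp)
  refine (ringHom_aeval _ _ _).trans (Eq.trans ?_ (aeval_esymm_comp _ e' n))
  congr 2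
  ext S : 1
  simp [e', map_prod, Finset.prod_map]

/-- The universal polynomial `P_{n,m}`: if `s_i` denotes the elementary symmetric polynomials in
`x_1, …, x_{nm}`, then `P_{n,m}(s_1, …, s_{nm})` is the coefficient of `t ^ n` in
`∏_{i_1 < ⋯ < i_m} (1 + x_{i_1} ⋯ x_{i_m} t)`, that is, the `n`-th elementary symmetric polynomial
of the products of `m` distinct variables. -/
noncomputable def compPoly (n m : ℕ) : MvPolynomial (Fin (n * m)) ℤ :=
  Classical.choose (exists_compPoly n m)

theorem compPoly_spec (n m : ℕ) :
    aeval (fun i : Fin (n * m) => esymm (Fin (n * m)) ℤ (i + 1)) (compPoly n m) =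
      aeval (fun S : {S : Finset (Fin (n * m)) // S.card = m} =>
          (∏ i ∈ S.1, X i : MvPolynomial (Fin (n * m)) ℤ))
        (esymm {S : Finset (Fin (n * m)) // S.card = m} ℤ n) :=
  Classical.choose_spec (exists_compPoly n m)

end UniversalPolynomials

section Newton

open MvPolynomial

/-- Newton's identities between a sequence of elementary symmetric functions `e` and a sequence of
power sums `p`. -/
def Newton {L : Type*} [CommRing L] (e p : ℕ → L) : Prop :=
  ∀ k : ℕ, (k : L) * e k = (-1) ^ (k + 1) *
    ∑ a ∈ Finset.HasAntidiagonal.antidiagonal k with a.1 < k, (-1) ^ a.1 * e a.1 * p a.2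

theorem Newton.map {L M : Type*} [CommRing L] [CommRing M] {e p : ℕ → L} (h : Newton e p)
    (f : L →+* M) : Newton (fun k => f (e k)) (fun k => f (p k)) := by
  intro k
  simpa using congrArg f (h k)

theorem newton_esymm {ι L : Type*} [Fintype ι] [CommRing L] (z : ι → L) :
    Newton (fun k => aeval z (esymm ι ℤ k)) (fun k => ∑ i, z i ^ k) := by
  intro k
  simpa [psum] using congrArg (aeval z) (mul_esymm_eq_sum ι ℤ k)

theorem Newton.e_unique {L : Type*} [CommRing L] [IsDomain L] [CharZero L] {e p e' p' : ℕ → L}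
    (h : Newton e p) (h' : Newton e' p') (h0 : e 0 = e' 0) {n : ℕ}
    (hp : ∀ k, 1 ≤ k → k ≤ n → p k = p' k) : ∀ k ≤ n, e k = e' k := by
  intro k
  induction k using Nat.strong_induction_on with
  | _ k ih =>
    intro hk
    rcases Nat.eq_zero_or_pos k with rfl | hk0
    · exact h0
    · apply mul_left_cancel₀ (Nat.cast_ne_zero.2 hk0.ne' : (k : L) ≠ 0)
      rw [h k, h' k]
      congr 1
      refine Finset.sum_congr rfl fun a ha => ?_
      simp only [Finset.mem_filter, Finset.HasAntidiagonal.mem_antidiagonal] at ha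
      rw [ih a.1 ha.2 (by omega), hp a.2 (by omega) (by omega)]

theorem Newton.p_unique {L : Type*} [CommRing L] {e p e' p' : ℕ → L}
    (h : Newton e p) (h' : Newton e' p') (h0 : e 0 = 1) {n : ℕ}
    (he : ∀ k ≤ n, e k = e' k) : ∀ k, 1 ≤ k → k ≤ n → p k = p' k := by
  intro k
  induction k using Nat.strong_induction_on with
  | _ k ih =>
    intro hk0 hk
    have h1 := h k
    rw [he k hk, h' k] at h1
    have hu : IsUnit ((-1 : L) ^ (k + 1)) := (isUnit_one.neg).pow _
    have h2 := hu.mul_left_cancel h1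
    have hm : (0, k) ∈ (Finset.HasAntidiagonal.antidiagonal k).filter (fun a => a.1 < k) := by simp; omega
    rw [← Finset.add_sum_erase _ _ hm, ← Finset.add_sum_erase _ _ hm] at h2
    have h3 : ∑ a ∈ ((Finset.HasAntidiagonal.antidiagonal k).filter (fun a => a.1 < k)).erase (0, k),
        (-1) ^ a.1 * e a.1 * p a.2 =
        ∑ a ∈ ((Finset.HasAntidiagonal.antidiagonal k).filter (fun a => a.1 < k)).erase (0, k),
        (-1) ^ a.1 * e' a.1 * p' a.2 := by
      refine Finset.sum_congr rfl fun a ha => ?_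
      simp only [Finset.mem_erase, Finset.mem_filter, Finset.HasAntidiagonal.mem_antidiagonal] at ha
      have : a.1 ≠ 0 := fun h => ha.1 (Prod.ext h (by simp; omega))
      rw [he a.1 (by omega), ih a.2 (by omega) (by omega) (by omega)]
    rw [h3, ← he 0 (Nat.zero_le _), h0] at h2
    simpa using (add_right_cancel h2).symm

theorem exists_map_eq_multiset {L : Type*} (n : ℕ) (s : Multiset L) (h : s.card = n) :
    ∃ x : Fin n → L, Finset.univ.val.map x = s := by
  subst h
  induction s using Quotient.inductionOn with
  | _ l => exact ⟨l.get, (Fin.univ_val_map l.get).trans (by rw [List.ofFn_get]; rfl)⟩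

/-- Over an algebraically closed field, prescribed values of the first `n` elementary symmetric
functions are attained. -/
theorem exists_esymm_eq {L : Type*} [Field L] [IsAlgClosed L] (n : ℕ) (e : ℕ → L) (h0 : e 0 = 1) :
    ∃ x : Fin n → L, ∀ k ≤ n, aeval x (esymm (Fin n) ℤ k) = e k := by
  let q : Polynomial L := ∑ k ∈ Finset.range (n + 1),
    Polynomial.C ((-1) ^ (n - k) * e (n - k)) * Polynomial.X ^ k
  have hc : ∀ k ≤ n, q.coeff k = (-1) ^ (n - k) * e (n - k) := by
    intro k hk
    simp only [q, Polynomial.finsetSum_coeff, Polynomial.coeff_C_mul_X_pow]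
    rw [Finset.sum_ite_eq, if_pos (by simp; omega)]
  have hd : q.natDegree ≤ n := by
    refine Polynomial.natDegree_sum_le_of_forall_le _ _ fun k hk => ?_
    exact (Polynomial.natDegree_C_mul_X_pow_le _ _).trans (by simp at hk; omega)
  have hn : q.coeff n = 1 := by simp [hc n le_rfl, h0]
  have hdeg : q.natDegree = n :=
    le_antisymm hd (Polynomial.le_natDegree_of_ne_zero (by rw [hn]; exact one_ne_zero))
  have hcard : q.roots.card = n := by
    rw [← hdeg]; exact Polynomial.splits_iff_card_roots.1 (IsAlgClosed.splits q)
  obtain ⟨x, hmap⟩ := exists_map_eq_multiset n q.roots hcard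
  refine ⟨x, fun k hk => ?_⟩
  rw [aeval_esymm_eq_multiset_esymm, hmap]
  have h1 := Polynomial.coeff_eq_esymm_roots_of_card (p := q) (by rw [hcard, hdeg])
    (k := n - k) (by omega)
  rw [hc _ (by omega), Polynomial.leadingCoeff, hdeg, hn, one_mul, Nat.sub_sub_self hk] at h1
  have hu : IsUnit ((-1 : L) ^ k) := (isUnit_one.neg).pow _
  exact (hu.mul_left_cancel h1).symm

end Newton

/-- A (special) `λ`-ring structure on a commutative ring. -/
class LambdaRing (R : Type*) [CommRing R] where
  /-- The operation `λ^n`. -/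
  lam : ℕ → R → R
  lam_zero : ∀ x, lam 0 x = 1
  lam_one : ∀ x, lam 1 x = x
  lam_apply_one : ∀ n, 2 ≤ n → lam n 1 = 0
  lam_add : ∀ n x y, lam n (x + y) = ∑ a ∈ Finset.HasAntidiagonal.antidiagonal n, lam a.1 x * lam a.2 y
  lam_mul : ∀ n x y, lam n (x * y) =
    MvPolynomial.aeval (Sum.elim (fun i : Fin n => lam (i + 1) x) (fun j : Fin n => lam (j + 1) y))
      (mulPoly n)
  lam_lam : ∀ n m x, lam n (lam m x) =
    MvPolynomial.aeval (fun i : Fin (n * m) => lam (i + 1) x) (compPoly n m)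


section Construction

open MvPolynomial


theorem lam_mul_of_newton {R L : Type*} [CommRing R] [IsDomain R] [CharZero R]
    [Field L] [IsAlgClosed L] [CharZero L] (f : R →+* L) (hf : Function.Injective f)
    (lam : ℕ → R → R) (psi : ℕ → R →+* R)
    (h0 : ∀ x, lam 0 x = 1) (hN : ∀ x, Newton (fun k => lam k x) (fun k => psi k x))
    (n : ℕ) (x y : R) : lam n (x * y) =
      aeval (Sum.elim (fun i : Fin n => lam (i + 1) x) (fun j : Fin n => lam (j + 1) y))
        (mulPoly n) := by
  obtain ⟨u, hu⟩ := exists_esymm_eq n (fun k => f (lam k x)) (by simp [h0])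
  obtain ⟨v, hv⟩ := exists_esymm_eq n (fun k => f (lam k y)) (by simp [h0])
  have pu := (newton_esymm u).p_unique ((hN x).map f) (by simp) hu
  have pv := (newton_esymm v).p_unique ((hN y).map f) (by simp) hv
  have key : f (lam n (x * y)) =
      aeval (fun p : Fin n × Fin n => u p.1 * v p.2) (esymm (Fin n × Fin n) ℤ n) := by
    refine Newton.e_unique ((hN (x * y)).map f)
      (newton_esymm (fun p : Fin n × Fin n => u p.1 * v p.2)) (by simp [h0]) ?_ n le_rfl
    intro k hk hkn
    simp only [map_mul, ← pu k hk hkn, ← pv k hk hkn, mul_pow]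
    rw [Finset.sum_mul_sum, ← Finset.sum_product', Finset.univ_product_univ]
  apply hf
  rw [key, ringHom_aeval]
  have := ((ringHom_aeval (aeval (R := ℤ) (Sum.elim u v)) _ _).symm.trans
    (congrArg (aeval (Sum.elim u v)) (mulPoly_spec n))).trans (ringHom_aeval _ _ _)
  simp only [map_mul, aeval_X, Sum.elim_inl, Sum.elim_inr] at this
  rw [← this]
  congr 2
  ext i
  rcases i with i | i
  · simp [aeval_rename, Function.comp_def, ← hu (i + 1) (by omega)]
  · simp [aeval_rename, Function.comp_def, ← hv (i + 1) (by omega)]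

theorem lam_lam_of_newton {R L : Type*} [CommRing R] [IsDomain R] [CharZero R]
    [Field L] [IsAlgClosed L] [CharZero L] (f : R →+* L) (hf : Function.Injective f)
    (lam : ℕ → R → R) (psi : ℕ → R →+* R)
    (h0 : ∀ x, lam 0 x = 1) (hpsi : ∀ k l x, psi k (psi l x) = psi (k * l) x)
    (hN : ∀ x, Newton (fun k => lam k x) (fun k => psi k x))
    (n m : ℕ) (x : R) : lam n (lam m x) =
      aeval (fun i : Fin (n * m) => lam (i + 1) x) (compPoly n m) := by
  have hcomm : ∀ k x, psi k (lam m x) = lam m (psi k x) := by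
    intro k x
    refine Newton.e_unique ((hN x).map (psi k)) (hN (psi k x)) (by simp [h0]) (n := m) ?_ m le_rfl
    intro l _ _
    simp only [hpsi, mul_comm]
  obtain ⟨u, hu⟩ := exists_esymm_eq (n * m) (fun k => f (lam k x)) (by simp [h0])
  have pu := (newton_esymm u).p_unique ((hN x).map f) (by simp) hu
  have key : f (lam n (lam m x)) =
      aeval (fun S : {S : Finset (Fin (n * m)) // S.card = m} => ∏ i ∈ S.1, u i)
        (esymm {S : Finset (Fin (n * m)) // S.card = m} ℤ n) := by
    refine Newton.e_unique ((hN (lam m x)).map f)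
      (newton_esymm (fun S : {S : Finset (Fin (n * m)) // S.card = m} => ∏ i ∈ S.1, u i))
      (by simp [h0]) ?_ n le_rfl
    intro k hk hkn
    have h1 : f (lam m (psi k x)) = aeval (fun i => u i ^ k) (esymm (Fin (n * m)) ℤ m) := by
      refine Newton.e_unique ((hN (psi k x)).map f) (newton_esymm (fun i => u i ^ k))
        (by simp [h0]) ?_ m le_rfl
      intro l hl hlm
      simp only [hpsi, ← pow_mul]
      rw [mul_comm l k, ← pu (k * l) (Nat.mul_pos hk hl) (Nat.mul_le_mul hkn hlm)]
    simp only [hcomm, h1, esymm, map_sum, map_prod, aeval_X, Finset.prod_pow]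
    refine Finset.sum_subtype _ (fun S => ?_) (fun S => (∏ i ∈ S, u i) ^ k)
    simp [Finset.mem_powersetCard]
  apply hf
  rw [key, ringHom_aeval]
  have := ((ringHom_aeval (aeval (R := ℤ) u) _ _).symm.trans
    (congrArg (aeval u) (compPoly_spec n m))).trans (ringHom_aeval _ _ _)
  simp only [map_prod, aeval_X] at this
  rw [← this]
  congr 2
  ext i
  exact hu (i + 1) (by omega)

end Construction

section Series

/-- Newton's identities in terms of generating series. -/
theorem newton_of_series {R : Type*} [CommRing R] (s : ℕ → R) (p : ℕ → R)
    (h : PowerSeries.derivative R (PowerSeries.mk s) =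
      PowerSeries.mk s * PowerSeries.mk (fun k => (-1) ^ k * p (k + 1))) : Newton s p := by
  intro k
  rcases k with _ | k
  · simp
  have h1 := congrArg (PowerSeries.coeff k) h
  rw [PowerSeries.coeff_derivative, PowerSeries.coeff_mul] at h1
  simp only [PowerSeries.coeff_mk] at h1
  rw [mul_comm, Nat.cast_add_one, h1, Finset.mul_sum]
  have h2 : (Finset.HasAntidiagonal.antidiagonal (k + 1)).filter (fun a => a.1 < k + 1) =
      (Finset.HasAntidiagonal.antidiagonal k).map
        (Function.Embedding.prodMap (Function.Embedding.refl ℕ) (addRightEmbedding 1)) := by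
    ext ⟨a, b⟩
    simp only [Finset.mem_filter, Finset.HasAntidiagonal.mem_antidiagonal, Finset.mem_map,
      Prod.exists, Function.Embedding.coe_prodMap, Prod.map_apply,
      Function.Embedding.refl_apply, addRightEmbedding_apply, Prod.mk.injEq]
    constructor
    · rintro ⟨h1, h2⟩
      exact ⟨a, b - 1, by omega, rfl, by omega⟩
    · rintro ⟨c, d, h1, rfl, rfl⟩
      omega
  rw [h2, Finset.sum_map]
  refine Finset.sum_congr rfl fun a ha => ?_
  have ha' : a.1 + a.2 = k := by simpa using ha
  simp only [Function.Embedding.coe_prodMap, Prod.map_fst, Prod.map_snd,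
    Function.Embedding.refl_apply, addRightEmbedding_apply]
  have h3 : (-1 : R) ^ (k + 1 + 1) * (-1) ^ a.1 = (-1) ^ a.2 := by
    rw [← ha', ← pow_add]
    have : a.1 + a.2 + 1 + 1 + a.1 = 2 * (a.1 + 1) + a.2 := by ring
    rw [this, pow_add, pow_mul]
    simp
  rw [← h3]
  ring

/-- If Newton's identities relate `λ_t` and the Adams operations on additive generators, they do so
everywhere. -/
theorem newton_of_closure {R : Type*} [CommRing R] (lt : R → PowerSeries R) (psi : ℕ → R →+* R)
    (h0 : lt 0 = 1) (hadd : ∀ f g, lt (f + g) = lt f * lt g) (G : Set R)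
    (hG : ∀ f ∈ G, lt f = 1 + PowerSeries.C f * PowerSeries.X)
    (hpsi : ∀ f ∈ G, ∀ k, psi k f = f ^ k) (f : R) (hf : f ∈ AddSubgroup.closure G) :
    Newton (fun k => PowerSeries.coeff k (lt f)) (fun k => psi k f) := by
  apply newton_of_series
  have hmk : ∀ f, PowerSeries.mk (fun k => PowerSeries.coeff k (lt f)) = lt f :=
    fun f => by ext1 k; simp
  rw [hmk]
  let Q : R → PowerSeries R := fun f => PowerSeries.mk fun k => (-1) ^ k * psi (k + 1) f
  have hQ : ∀ f g, Q (f + g) = Q f + Q g := fun f g => by ext1 k; simp [Q, mul_add]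
  have hQ0 : Q 0 = 0 := by ext1 k; simp [Q]
  change PowerSeries.derivative R (lt f) = lt f * Q f
  induction hf using AddSubgroup.closure_induction with
  | mem f hf =>
    rw [hG f hf]
    ext1 k
    rw [PowerSeries.coeff_derivative, add_mul, one_mul, mul_assoc]
    rcases k with _ | k
    · simp [Q, PowerSeries.coeff_one, hpsi f hf]
    · simp [Q, PowerSeries.coeff_one, hpsi f hf, PowerSeries.coeff_succ_X_mul]
      ring
  | zero => simp [hQ0, h0]
  | add f g _ _ hf hg =>
    rw [hadd, Derivation.leibniz, hf, hg, hQ]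
    simp only [smul_eq_mul]
    ring
  | neg f _ hf =>
    have h1 : lt f * lt (-f) = 1 := by rw [← hadd, add_neg_cancel, h0]
    have hQn : Q f + Q (-f) = 0 := by rw [← hQ, add_neg_cancel, hQ0]
    have h2 := congrArg (PowerSeries.derivative R) h1
    rw [Derivation.leibniz, hf] at h2
    simp only [smul_eq_mul, Derivation.map_one_eq_zero] at h2
    apply (IsUnit.of_mul_eq_one _ h1).mul_left_cancel
    linear_combination h2 - lt f * lt (-f) * hQn

/-- The `λ`-ring structure on a torsion-free domain determined by a series `λ_t` and Adams
operations which are compatible on additive generators of rank one. -/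
noncomputable abbrev LambdaRing.ofSeries {R : Type*} [CommRing R] [IsDomain R] [CharZero R]
    (lam : ℕ → R → R) (lt : R → PowerSeries R) (psi : ℕ → R →+* R)
    (hl : ∀ n f, PowerSeries.coeff n (lt f) = lam n f) (hc : ∀ f, lam 0 f = 1) (h0 : lt 0 = 1)
    (hadd : ∀ f g, lt (f + g) = lt f * lt g) (G : Set R) (h1 : (1 : R) ∈ G)
    (hG : ∀ f ∈ G, lt f = 1 + PowerSeries.C f * PowerSeries.X)
    (hpsi : ∀ f ∈ G, ∀ k, psi k f = f ^ k) (hcl : ∀ f, f ∈ AddSubgroup.closure G)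
    (hpp : ∀ k l x, psi k (psi l x) = psi (k * l) x) (hp1 : ∀ x, psi 1 x = x) :
    LambdaRing R :=
  have hN := fun f => newton_of_closure lt psi h0 hadd G hG hpsi f (hcl f)
  have hN' : ∀ f, Newton (fun k => lam k f) (fun k => psi k f) := fun f => by
    simpa only [hl] using hN f
  have hinj : Function.Injective (algebraMap R (AlgebraicClosure (FractionRing R))) := by
    rw [IsScalarTower.algebraMap_eq R (FractionRing R)]
    exact (algebraMap (FractionRing R) _).injective.comp (IsFractionRing.injective R _)
  haveI : CharZero (AlgebraicClosure (FractionRing R)) := charZero_of_injective_algebraMap hinj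
  { lam := lam
    lam_zero := hc
    lam_one := fun f => by
      have := hN' f 1
      simp only [Nat.cast_one, one_mul] at this
      rw [this, Finset.sum_filter]
      simp [Finset.Nat.antidiagonal_succ, hc, hp1]
    lam_apply_one := fun n hn => by
      obtain ⟨k, rfl⟩ : ∃ k, n = k + 2 := ⟨n - 2, by omega⟩
      rw [← hl, hG 1 h1]
      simp [PowerSeries.coeff_one, PowerSeries.coeff_X]
    lam_add := fun n f g => by simp only [← hl, hadd, PowerSeries.coeff_mul]
    lam_mul := fun n f g => lam_mul_of_newton _ hinj _ psi hc hN' n f g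
    lam_lam := fun n m f => lam_lam_of_newton _ hinj _ psi hc hpp hN' n m f }

theorem choose_one_eq (k : ℕ) : Ring.choose (1 : ℤ) k = if k ≤ 1 then 1 else 0 := by
  have := Ring.choose_natCast (R := ℤ) 1 k
  rw [Nat.cast_one] at this
  rw [this]
  rcases k with _ | _ | k <;> simp [Nat.choose_eq_zero_of_lt]

end Series

/-- The canonical `λ`-ring structure on `ℤ`: `λ^n(a) = binom(a, n)`. -/
noncomputable instance intLambdaRing : LambdaRing ℤ :=
  LambdaRing.ofSeries (fun n a => Ring.choose a n)
    (fun a => PowerSeries.mk fun n => Ring.choose a n) (fun _ => RingHom.id ℤ)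
    (fun n a => PowerSeries.coeff_mk _ _) (fun a => by simp)
    (by
      ext1 k
      rw [PowerSeries.coeff_mk, PowerSeries.coeff_one, Ring.choose_zero_ite])
    (fun a b => by
      ext1 k
      simp only [PowerSeries.coeff_mul, PowerSeries.coeff_mk]
      exact Ring.add_choose_eq k (Commute.all _ _))
    {1} rfl
    (by
      rintro _ rfl
      ext1 k
      rw [PowerSeries.coeff_mk, choose_one_eq]
      rcases k with _ | _ | k <;> simp [PowerSeries.coeff_one, PowerSeries.coeff_X])
    (by rintro _ rfl k; simp)
    (fun a => by simp)
    (fun _ _ _ => rfl) (fun _ => rfl)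

section AffineLine

open Polynomial

/-- The operation `λ_t` on `ℤ[x]`, the monoid ring of `(ℕ, +)`: the extension of
`λ_t(x ^ i) = 1 + x ^ i t` that turns sums into products, that is,
`λ_t(∑ a_i x ^ i) = ∏ (1 + x ^ i t) ^ {a_i}`. -/
noncomputable def lamSeries (f : ℤ[X]) : PowerSeries ℤ[X] :=
  ∏ i ∈ f.support, PowerSeries.mk fun k => C (Ring.choose (f.coeff i) k) * (X ^ i) ^ k

theorem lamSeries_eq {f : ℤ[X]} {s : Finset ℕ} (h : f.support ⊆ s) :
    lamSeries f = ∏ i ∈ s, PowerSeries.mk fun k => C (Ring.choose (f.coeff i) k) * (X ^ i) ^ k := by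
  refine Finset.prod_subset h fun i _ hi => ?_
  rw [notMem_support_iff.1 hi]
  ext1 k
  rw [PowerSeries.coeff_mk, PowerSeries.coeff_one, Ring.choose_zero_ite]
  split_ifs with hk <;> simp [hk]

theorem lamSeries_add (f g : ℤ[X]) : lamSeries (f + g) = lamSeries f * lamSeries g := by
  rw [lamSeries_eq (s := f.support ∪ g.support) support_add,
    lamSeries_eq (f := f) Finset.subset_union_left,
    lamSeries_eq (f := g) Finset.subset_union_right, ← Finset.prod_mul_distrib]
  refine Finset.prod_congr rfl fun i _ => ?_
  ext1 k
  rw [PowerSeries.coeff_mul, PowerSeries.coeff_mk, coeff_add,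
    Ring.add_choose_eq k (Commute.all _ _), map_sum, Finset.sum_mul]
  refine Finset.sum_congr rfl fun a ha => ?_
  have ha' : a.1 + a.2 = k := by simpa using ha
  rw [PowerSeries.coeff_mk, PowerSeries.coeff_mk, ← ha', pow_add, map_mul]
  ring

/-- The generators `x ^ i` satisfy `λ_t(x ^ i) = 1 + x ^ i t`. -/
theorem lamSeries_X_pow (i : ℕ) :
    lamSeries (X ^ i) = 1 + PowerSeries.C (X ^ i) * PowerSeries.X := by
  have hs : (X ^ i : ℤ[X]).support ⊆ {i} := by
    rw [← one_mul (X ^ i : ℤ[X]), ← C_1]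
    exact support_C_mul_X_pow_subset i 1
  rw [lamSeries_eq hs, Finset.prod_singleton, coeff_X_pow_self]
  ext1 k
  rw [PowerSeries.coeff_mk, choose_one_eq]
  rcases k with _ | _ | k <;>
    simp [PowerSeries.coeff_one, -map_pow, PowerSeries.coeff_succ_mul_X, PowerSeries.coeff_C]

/-- The `λ`-ring structure on `ℤ[x]` with `λ^n(x ^ i) = 0` for `n > 1`. -/
noncomputable instance polyLambdaRing : LambdaRing ℤ[X] :=
  LambdaRing.ofSeries (fun n f => PowerSeries.coeff n (lamSeries f)) lamSeries
    (fun k => (expand ℤ k).toRingHom) (fun _ _ => rfl)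
    (fun f => by simp [lamSeries, PowerSeries.coeff_zero_eq_constantCoeff_apply, map_prod])
    (by simp [lamSeries]) lamSeries_add (Set.range fun i : ℕ => (X : ℤ[X]) ^ i) ⟨0, by simp⟩
    (by rintro _ ⟨i, rfl⟩; exact lamSeries_X_pow i)
    (by
      rintro _ ⟨i, rfl⟩ k
      simp [← pow_mul, mul_comm])
    (fun f => by
      induction f using Polynomial.induction_on' with
      | add p q hp hq => exact AddSubgroup.add_mem _ hp hq
      | monomial n a =>
        have : (monomial n a : ℤ[X]) = a • (X ^ n) := by
          rw [smul_X_eq_monomial]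
        rw [this]
        exact AddSubgroup.zsmul_mem _ (AddSubgroup.subset_closure (Set.mem_range_self n)) a)
    (fun k l f => by simp [expand_expand])
    (fun f => by simp)

/-- The augmentation `ℤ[x] → ℤ`, `x ↦ 0`, commutes with the `λ`-operations. -/
theorem eval_zero_lam (n : ℕ) (f : ℤ[X]) :
    evalRingHom 0 (LambdaRing.lam n f) = LambdaRing.lam n (evalRingHom 0 f) := by
  change evalRingHom 0 (PowerSeries.coeff n (lamSeries f)) = Ring.choose (evalRingHom 0 f) n
  rw [← PowerSeries.coeff_map, lamSeries_eq (Finset.subset_insert 0 f.support), map_prod,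
    ← Finset.mul_prod_erase _ _ (Finset.mem_insert_self 0 _), Finset.prod_eq_one, mul_one]
  · simp [coeff_zero_eq_eval_zero]
  · intro i hi
    have hi0 : i ≠ 0 := Finset.ne_of_mem_erase hi
    ext1 k
    rw [PowerSeries.coeff_map, PowerSeries.coeff_mk, PowerSeries.coeff_one]
    rcases k with _ | k
    · simp
    · simp [hi0]

end AffineLine

section Category

/-- Homomorphisms of `λ`-rings: ring homomorphisms that commute with the `λ`-operations. -/
@[ext]
structure LambdaHom (R S : Type*) [CommRing R] [LambdaRing R] [CommRing S] [LambdaRing S] where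
  /-- The underlying ring homomorphism. -/
  toRingHom : R →+* S
  map_lam : ∀ n x, toRingHom (LambdaRing.lam n x) = LambdaRing.lam n (toRingHom x)

instance (R S : Type*) [CommRing R] [LambdaRing R] [CommRing S] [LambdaRing S] :
    FunLike (LambdaHom R S) R S where
  coe f := f.toRingHom
  coe_injective _ _ h := LambdaHom.ext (RingHom.ext (congrFun h))

/-- The category of (commutative, unital) `λ`-rings. -/
structure LambdaRingCat where
  /-- The underlying type. -/
  carrier : Type
  [commRing : CommRing carrier]
  [lambdaRing : LambdaRing carrier]

attribute [instance] LambdaRingCat.commRing LambdaRingCat.lambdaRing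

instance : CoeSort LambdaRingCat Type := ⟨LambdaRingCat.carrier⟩

instance : Category LambdaRingCat where
  Hom A B := LambdaHom A B
  id A := ⟨RingHom.id A, fun _ _ => rfl⟩
  comp f g := ⟨g.toRingHom.comp f.toRingHom, fun n x => by simp [f.map_lam, g.map_lam]⟩

instance : ConcreteCategory LambdaRingCat (fun A B => LambdaHom A B) where
  hom f := f
  ofHom f := f

/-- A ring with operations that maps jointly injectively to two `λ`-rings, compatibly with the
operations, is a `λ`-ring. -/
abbrev LambdaRing.ofJointlyInjective {S A B : Type*} [CommRing S] [CommRing A] [CommRing B]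
    [LambdaRing A] [LambdaRing B] (f : S →+* A) (g : S →+* B)
    (hinj : ∀ x y, f x = f y → g x = g y → x = y) (lam : ℕ → S → S)
    (hf : ∀ n x, f (lam n x) = LambdaRing.lam n (f x))
    (hg : ∀ n x, g (lam n x) = LambdaRing.lam n (g x)) : LambdaRing S where
  lam := lam
  lam_zero x := hinj _ _ (by simp [hf, LambdaRing.lam_zero]) (by simp [hg, LambdaRing.lam_zero])
  lam_one x := hinj _ _ (by simp [hf, LambdaRing.lam_one]) (by simp [hg, LambdaRing.lam_one])
  lam_apply_one n hn := hinj _ _ (by simp [hf, LambdaRing.lam_apply_one n hn])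
    (by simp [hg, LambdaRing.lam_apply_one n hn])
  lam_add n x y := hinj _ _ (by simp [hf, LambdaRing.lam_add])
    (by simp [hg, LambdaRing.lam_add])
  lam_mul n x y := hinj _ _
    (by
      rw [hf, map_mul, LambdaRing.lam_mul, ringHom_aeval]
      congr 2
      ext i
      rcases i with i | i <;> simp [hf])
    (by
      rw [hg, map_mul, LambdaRing.lam_mul, ringHom_aeval]
      congr 2
      ext i
      rcases i with i | i <;> simp [hg])
  lam_lam n m x := hinj _ _
    (by
      rw [hf, hf, LambdaRing.lam_lam, ringHom_aeval]
      congr 2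
      ext i
      simp [hf])
    (by
      rw [hg, hg, LambdaRing.lam_lam, ringHom_aeval]
      congr 2
      ext i
      simp [hg])

variable {A B X : LambdaRingCat} (f : A ⟶ X) (g : B ⟶ X)

/-- The ring `{(a, b) | f a = g b}`. -/
abbrev fiberSubring : Subring (A × B) :=
  (f.toRingHom.comp (RingHom.fst A B)).eqLocus (g.toRingHom.comp (RingHom.snd A B))

/-- The fibre product of two `λ`-rings, with componentwise operations. -/
instance fiberLambdaRing : LambdaRing (fiberSubring f g) :=
  LambdaRing.ofJointlyInjective
    ((RingHom.fst A B).comp (fiberSubring f g).subtype)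
    ((RingHom.snd A B).comp (fiberSubring f g).subtype)
    (fun x y h1 h2 => Subtype.ext (Prod.ext h1 h2))
    (fun n x => ⟨(LambdaRing.lam n x.1.1, LambdaRing.lam n x.1.2), by
      have hx : f.toRingHom x.1.1 = g.toRingHom x.1.2 := x.2
      change f.toRingHom (LambdaRing.lam n x.1.1) = g.toRingHom (LambdaRing.lam n x.1.2)
      rw [f.map_lam, g.map_lam, hx]⟩)
    (fun _ _ => rfl) (fun _ _ => rfl)

/-- The fibre product as a cone over `A ⟶ X ⟵ B`. -/
def fiberCone : PullbackCone f g :=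
  PullbackCone.mk (W := ⟨fiberSubring f g⟩)
    (⟨(RingHom.fst A B).comp (fiberSubring f g).subtype, fun _ _ => rfl⟩ : LambdaHom _ A)
    (⟨(RingHom.snd A B).comp (fiberSubring f g).subtype, fun _ _ => rfl⟩ : LambdaHom _ B)
    (LambdaHom.ext (RingHom.ext fun x => x.2))

/-- The fibre product is a pullback in the category of `λ`-rings. -/
def fiberConeIsLimit : IsLimit (fiberCone f g) :=
  PullbackCone.IsLimit.mk _
    (fun s => (⟨(s.fst.toRingHom.prod s.snd.toRingHom).codRestrict (fiberSubring f g)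
        (fun x => RingHom.congr_fun (congrArg LambdaHom.toRingHom s.condition) x),
      fun n x => Subtype.ext (Prod.ext (s.fst.map_lam n x) (s.snd.map_lam n x))⟩ : LambdaHom _ _))
    (fun _ => rfl) (fun _ => rfl)
    (fun _ _ h1 h2 => LambdaHom.ext (RingHom.ext fun x => Subtype.ext (Prod.ext
      (RingHom.congr_fun (congrArg LambdaHom.toRingHom h1) x)
      (RingHom.congr_fun (congrArg LambdaHom.toRingHom h2) x))))

/-- Finite products in the category of `λ`-rings over `X`: the terminal object is `X` and binary
products are fibre products over `X`. -/
instance overCartesian (X : LambdaRingCat) : CartesianMonoidalCategory (Over X) :=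
  .ofChosenFiniteProducts
    ⟨asEmptyCone (Over.mk (𝟙 X)), IsTerminal.ofUniqueHom (fun Y => Over.homMk Y.hom)
      fun Y m => Over.OverMorphism.ext (by simpa using m.w)⟩
    fun Y Z => ⟨pullbackConeEquivBinaryFan.functor.obj (fiberCone Y.hom Z.hom),
      (fiberConeIsLimit Y.hom Z.hom).pullbackConeEquivBinaryFanFunctor⟩

instance overBraided (X : LambdaRingCat) : BraidedCategory (Over X) :=
  .ofCartesianMonoidalCategory

/-- The `λ`-ring `F_1`: the integers with `λ^n(a) = binom(a, n)`. -/
noncomputable def F1 : LambdaRingCat := ⟨ℤ⟩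

/-- The category of `λ`-modules over `R`: abelian group objects in the category of `λ`-rings
over `R`. -/
abbrev LambdaMod (R : LambdaRingCat) := CommGrp (Over R)

/-- The affine line `ℤ[x]` over `F_1`, an object over `F_1` through `x ↦ 0`. -/
noncomputable def affineLine : Over F1 :=
  Over.mk (Y := (⟨Polynomial ℤ⟩ : LambdaRingCat))
    (⟨Polynomial.evalRingHom 0, eval_zero_lam⟩ : LambdaHom (Polynomial ℤ) ℤ)

end Category

section Zeta

universe v u v' u'

variable {C : Type u} [Category.{v} C] {D : Type u'} [Category.{v'} D]

/-- A zero morphism: one that factors through a zero object. -/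
def IsZeroMorphism {X Y : C} (f : X ⟶ Y) : Prop :=
  ∃ (Z : C) (a : X ⟶ Z) (b : Z ⟶ Y), IsZero Z ∧ f = a ≫ b

/-- `X` is simple: every morphism out of `X` is a monomorphism or zero. -/
def IsSimpleObject (X : C) : Prop :=
  ∀ (Y : C) (f : X ⟶ Y), Mono f ∨ IsZeroMorphism f

/-- `X` is finite: its norm `|End(X)|` is finite. -/
def IsFiniteObject (X : C) : Prop := Finite (X ⟶ X)

/-- The geometric norm `n(P) = |Hom(A, U P)|` with respect to an affine line `A` in a category `D`
and a functor `U : C ⥤ D`. -/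
noncomputable def geometricNorm (U : C ⥤ D) (A : D) (P : C) : ℕ := Nat.card (A ⟶ U.obj P)

/-- `P` is non-degenerate: `P` is simple and finite, and `1 < n(P) < ∞`. -/
structure IsNondegenerate (U : C ⥤ D) (A : D) (P : C) : Prop where
  simple : IsSimpleObject P
  finite : IsFiniteObject P
  finite_hom : Finite (A ⟶ U.obj P)
  one_lt : 1 < geometricNorm U A P

theorem geometricNorm_eq_of_iso (U : C ⥤ D) (A : D) {P Q : C} (e : P ≅ Q) :
    geometricNorm U A P = geometricNorm U A Q :=
  Nat.card_congr ((U.mapIso e).homToEquiv)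

/-- The geometric norm of an isomorphism class. -/
noncomputable def classNorm (U : C ⥤ D) (A : D) : Quotient (isIsomorphicSetoid C) → ℕ :=
  Quotient.lift (geometricNorm U A) fun _ _ h => h.elim (geometricNorm_eq_of_iso U A)

/-- The set of isomorphism classes of non-degenerate objects. -/
def nondegenerateClasses (U : C ⥤ D) (A : D) : Set (Quotient (isIsomorphicSetoid C)) :=
  {c | ∃ P : C, IsNondegenerate U A P ∧ c = Quotient.mk (isIsomorphicSetoid C) P}

/-- The Euler factor `(1 - n(P)^{-s})⁻¹` of a class. -/
noncomputable def geometricFactor (U : C ⥤ D) (A : D) (s : ℂ) (c : nondegenerateClasses U A) : ℂ :=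
  (1 - (classNorm U A c.1 : ℂ) ^ (-s))⁻¹

/-- The geometric zeta function `ζ_g(s, C) = ∏ (1 - n(P)^{-s})⁻¹`, over the isomorphism classes
of non-degenerate objects. -/
noncomputable def geometricZeta (U : C ⥤ D) (A : D) (s : ℂ) : ℂ :=
  ∏' c : nondegenerateClasses U A, geometricFactor U A s c

end Zeta

end FOne

/-! An abelian group object `P` over `F_1` is the same as a square-zero extension `ℤ ⊕ I` with its
unique group law `x + y - ε(x)`, where `ε` is the augmentation and `I` its kernel. The unit laws
force this formula (`mulMap_eq`), its multiplicativity forces `I² = 0` (`isSqZero_mod`), and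
conversely `I² = 0` makes the formula a group law (`IsSqZero.toMod`). Hence every morphism over
`F_1` between such objects is a morphism of groups, and one may compute with rings.

A morphism `ℤ[x] → P` is determined by the image of `x`, an element of `I` killed by all `λ^n` with
`n ≥ 2`, called primitive here. For `I = ℤ/n` with these operations zero (`cyclicMod n`) every
element occurs, so the norm is `n` (`geometricNorm_cyclicMod`). For `p` prime this object is simple
and non-degenerate.

Conversely, let `P` be non-degenerate. Since `n(P) > 1`, there is a primitive `m ≠ 0`. The subgroup
`ℤm` is an ideal stable under the operations, so `P` has a quotient by it (`exists_quotient`). The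
projection kills `m`, hence is not mono, hence is zero by simplicity, and `I = ℤm`. Thus `P` is
`cyclicMod n` with `n` the order of `m`. Finiteness of `n(P)` excludes infinite order, and
simplicity makes `n` prime (`exists_iso_cyclicMod`). The classes are therefore indexed by the
primes, with `p` as norm, and the product is Euler's. -/

namespace FOne

/-! ### The generating series `λ_t`, and transfer of `λ`-structures along surjections. -/

section LambdaSeries

variable {R : Type*} [CommRing R] [LambdaRing R]

/-- The generating series `λ_t(x) = ∑ λ^n(x) t ^ n`. -/
def lamT (x : R) : PowerSeries R := PowerSeries.mk fun n => LambdaRing.lam n x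

@[simp]
theorem coeff_lamT (n : ℕ) (x : R) : PowerSeries.coeff n (lamT x) = LambdaRing.lam n x :=
  PowerSeries.coeff_mk _ _

theorem lamT_add (x y : R) : lamT (x + y) = lamT x * lamT y := by
  ext1 n
  simp [PowerSeries.coeff_mul, LambdaRing.lam_add]

/-- The series has constant term `1`, so it is a unit, and `0 + 0 = 0` makes it idempotent. -/
theorem lamT_zero : lamT (0 : R) = 1 := by
  have hu : IsUnit (lamT (0 : R)) := by
    rw [PowerSeries.isUnit_iff_constantCoeff, ← PowerSeries.coeff_zero_eq_constantCoeff_apply,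
      coeff_lamT, LambdaRing.lam_zero]
    exact isUnit_one
  apply hu.mul_left_cancel
  rw [← lamT_add, add_zero, mul_one]

theorem lamT_one : lamT (1 : R) = 1 + PowerSeries.X := by
  ext1 n
  rcases n with _ | _ | n
  · simp [LambdaRing.lam_zero]
  · simp [LambdaRing.lam_one, PowerSeries.coeff_one]
  · simp [LambdaRing.lam_apply_one, PowerSeries.coeff_one, PowerSeries.coeff_X]

theorem lam_apply_zero {n : ℕ} (hn : n ≠ 0) : LambdaRing.lam n (0 : R) = 0 := by
  rw [← coeff_lamT, lamT_zero, PowerSeries.coeff_one, if_neg hn]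

/-- `λ_t` as a homomorphism from the additive to the multiplicative group. -/
def lamTHom : Multiplicative R →* PowerSeries R where
  toFun x := lamT x.toAdd
  map_one' := lamT_zero
  map_mul' x y := lamT_add x.toAdd y.toAdd

/-- Both sides come from homomorphisms from the additive group `ℤ` to power series under
multiplication; they agree at the generator `1`, where `λ_t(1) = 1 + t`. This makes `ℤ → R` a
`λ`-homomorphism. -/
theorem lam_intCast (n : ℕ) (k : ℤ) :
    LambdaRing.lam n (k : R) = ((LambdaRing.lam n k : ℤ) : R) := by
  have h : (lamTHom (R := R)).comp (AddMonoidHom.toMultiplicative (Int.castAddHom R)) =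
      (PowerSeries.map (Int.castRingHom R)).toMonoidHom.comp (lamTHom (R := ℤ)) := by
    apply MonoidHom.ext_mint
    simp [lamTHom, lamT_one]
  have := congrArg (PowerSeries.coeff n) (DFunLike.congr_fun h (Multiplicative.ofAdd k))
  simpa [lamTHom] using this

/-- A surjective image of a `λ`-ring, with compatible operations, is a `λ`-ring. -/
abbrev LambdaRing.ofSurjective {S : Type*} [CommRing S] (f : R →+* S)
    (hf : Function.Surjective f) (lam : ℕ → S → S)
    (h : ∀ n x, f (LambdaRing.lam n x) = lam n (f x)) : LambdaRing S where
  lam := lam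
  lam_zero := hf.forall.2 fun x => by rw [← h, LambdaRing.lam_zero, map_one]
  lam_one := hf.forall.2 fun x => by rw [← h, LambdaRing.lam_one]
  lam_apply_one n hn := by rw [← map_one f, ← h, LambdaRing.lam_apply_one n hn, map_zero]
  lam_add n := hf.forall₂.2 fun x y => by
    rw [← map_add, ← h, LambdaRing.lam_add]
    simp [h]
  lam_mul n := hf.forall₂.2 fun x y => by
    rw [← map_mul, ← h, LambdaRing.lam_mul, ringHom_aeval]
    congr 2
    ext i
    rcases i with i | i <;> simp [h]
  lam_lam n m := hf.forall.2 fun x => by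
    rw [← h, ← h, LambdaRing.lam_lam, ringHom_aeval]
    congr 2
    ext i
    simp [h]

end LambdaSeries

/-! ### Elementwise description of `λ`-rings over `F_1`. -/

section OverF1

variable {Y Z W : Over F1}

/-- The augmentation of a `λ`-ring over `F_1`. -/
noncomputable def aug (Y : Over F1) : Y.left →+* ℤ :=
  (show LambdaHom Y.left ℤ from Y.hom).toRingHom

theorem aug_lam (n : ℕ) (x : Y.left) : aug Y (LambdaRing.lam n x) = LambdaRing.lam n (aug Y x) :=
  (show LambdaHom Y.left ℤ from Y.hom).map_lam n x

/-- The underlying ring homomorphism of a morphism over `F_1`. -/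
noncomputable def ringMap (f : Y ⟶ Z) : Y.left →+* Z.left := f.left.toRingHom

theorem ringMap_lam (f : Y ⟶ Z) (n : ℕ) (x : Y.left) :
    ringMap f (LambdaRing.lam n x) = LambdaRing.lam n (ringMap f x) :=
  f.left.map_lam n x

theorem aug_ringMap (f : Y ⟶ Z) (x : Y.left) : aug Z (ringMap f x) = aug Y x :=
  RingHom.congr_fun (congrArg LambdaHom.toRingHom (Over.w f)) x

@[simp]
theorem ringMap_comp (f : Y ⟶ Z) (g : Z ⟶ W) (x : Y.left) :
    ringMap (f ≫ g) x = ringMap g (ringMap f x) := rfl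

theorem over_hom_ext {f g : Y ⟶ Z} (h : ∀ x, ringMap f x = ringMap g x) : f = g :=
  Over.OverMorphism.ext (LambdaHom.ext (RingHom.ext h))

/-- A morphism over `F_1` from a ring homomorphism compatible with the structure. -/
noncomputable def overHomMk (f : Y.left →+* Z.left)
    (hl : ∀ n x, f (LambdaRing.lam n x) = LambdaRing.lam n (f x))
    (ha : ∀ x, aug Z (f x) = aug Y x) : Y ⟶ Z :=
  Over.homMk (⟨f, hl⟩ : LambdaHom Y.left Z.left) (LambdaHom.ext (RingHom.ext ha))

@[simp]
theorem ringMap_overHomMk (f : Y.left →+* Z.left) (hl) (ha) (x : Y.left) :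
    ringMap (overHomMk f hl ha) x = f x := rfl

/-! ### Square-zero extensions of `F_1` are abelian group objects. -/

/-- The augmentation ideal has square zero. -/
def IsSqZero (Y : Over F1) : Prop := ∀ x y : Y.left, aug Y x = 0 → aug Y y = 0 → x * y = 0

/-- The fibre square of `Y` over `F_1`. -/
noncomputable abbrev fiberSq (Y : Over F1) : Over F1 := MonoidalCategoryStruct.tensorObj Y Y

/-- The coefficients of `λ_t(x) - 1` and `λ_t(y) - 1` lie in the augmentation ideal, so the product
of these series vanishes. Thus each `λ^n` with `n ≥ 1` is additive on that ideal. -/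
theorem IsSqZero.lamT_add (h : IsSqZero Y) {x y : Y.left} (hx : aug Y x = 0) (hy : aug Y y = 0) :
    lamT (x + y) = lamT x + lamT y - 1 := by
  have hk : ∀ x : Y.left, aug Y x = 0 → ∀ i, aug Y (PowerSeries.coeff i (lamT x - 1)) = 0 := by
    intro x hx i
    rcases eq_or_ne i 0 with rfl | hi
    · rw [map_sub, coeff_lamT, LambdaRing.lam_zero]
      simp
    · simp [PowerSeries.coeff_one, hi, aug_lam, hx, lam_apply_zero hi]
  have h0 : (lamT x - 1) * (lamT y - 1) = 0 := by
    ext1 n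
    rw [PowerSeries.coeff_mul, map_zero]
    exact Finset.sum_eq_zero fun a _ => h _ _ (hk x hx _) (hk y hy _)
  rw [FOne.lamT_add]
  linear_combination h0

theorem IsSqZero.lamT_neg (h : IsSqZero Y) {x : Y.left} (hx : aug Y x = 0) :
    lamT (-x) = 2 - lamT x := by
  have := h.lamT_add hx (y := -x) (by simp [hx])
  rw [add_neg_cancel, lamT_zero] at this
  linear_combination -this

theorem aug_intCast (k : ℤ) : aug Y (k : Y.left) = k := by simp

theorem aug_sub (x : Y.left) : aug Y (x - (aug Y x : ℤ)) = 0 := by simp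

/-- Write `x = k + u` and `y = k + v` with `k` the common augmentation. The argument on the left is
`k + (u + v)`, and `λ_t` is additive up to the constant `1` on `u` and `v`. This is the
compatibility of the group law with the operations. -/
theorem IsSqZero.lamT_add_sub (h : IsSqZero Y) {x y : Y.left} (hxy : aug Y x = aug Y y) :
    lamT (x + y - (aug Y x : ℤ)) = lamT x + lamT y - lamT ((aug Y x : ℤ) : Y.left) := by
  obtain ⟨u, hu⟩ : ∃ u, x = (aug Y x : ℤ) + u := ⟨x - (aug Y x : ℤ), by ring⟩
  obtain ⟨v, hv⟩ : ∃ v, y = (aug Y x : ℤ) + v := ⟨y - (aug Y x : ℤ), by ring⟩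
  have hu0 : aug Y u = 0 := by have := congrArg (aug Y) hu; simpa using this
  have hv0 : aug Y v = 0 := by have := congrArg (aug Y) hv; simpa [hxy] using this
  generalize aug Y x = k at *
  subst hu hv
  rw [show (k : Y.left) + u + (k + v) - k = k + (u + v) by ring, FOne.lamT_add _ (u + v),
    FOne.lamT_add _ u, FOne.lamT_add (k : Y.left) v, h.lamT_add hu0 hv0]
  ring

/-- With `x = k + u` the argument on the left is `k - u`. This is the compatibility of the inverse
with the operations. -/
theorem IsSqZero.lamT_sub (h : IsSqZero Y) (x : Y.left) :
    lamT ((aug Y x : ℤ) + (aug Y x : ℤ) - x) =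
    lamT ((aug Y x : ℤ) : Y.left) + lamT ((aug Y x : ℤ) : Y.left) - lamT x := by
  obtain ⟨u, hu⟩ : ∃ u, x = (aug Y x : ℤ) + u := ⟨x - (aug Y x : ℤ), by ring⟩
  have hu0 : aug Y u = 0 := by have := congrArg (aug Y) hu; simpa using this
  generalize aug Y x = k at *
  subst hu
  rw [show (k : Y.left) + k - (k + u) = k + -u by ring, FOne.lamT_add, FOne.lamT_add,
    h.lamT_neg hu0]
  ring

/-- Expand `(x - ε(x)) (y - ε(y)) = 0`. Products become linear in the nilpotent parts, which reduces
the multiplicativity of addition and negation to `ring`. -/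
theorem IsSqZero.mul_eq (h : IsSqZero Y) (x y : Y.left) :
    x * y = (aug Y x : ℤ) * y + x * (aug Y y : ℤ) - (aug Y x : ℤ) * (aug Y y : ℤ) := by
  have := h _ _ (aug_sub x) (aug_sub y)
  linear_combination this

theorem fiber_aug (x : fiberSubring Y.hom Y.hom) : aug Y x.1.1 = aug Y x.1.2 := x.2

/-- The addition `(x, y) ↦ x + y - ε(x)` as a ring homomorphism. -/
noncomputable def IsSqZero.addRingHom (h : IsSqZero Y) : fiberSubring Y.hom Y.hom →+* Y.left where
  toFun x := x.1.1 + x.1.2 - (aug Y x.1.1 : ℤ)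
  map_one' := by simp
  map_zero' := by simp
  map_add' x y := by
    simp only [Subring.coe_add, Prod.fst_add, Prod.snd_add, map_add, Int.cast_add]
    ring
  map_mul' x y := by
    simp only [Subring.coe_mul, Prod.fst_mul, Prod.snd_mul, map_mul, Int.cast_mul]
    have h1 := h.mul_eq (x.1.1 + x.1.2 - (aug Y x.1.1 : ℤ)) (y.1.1 + y.1.2 - (aug Y y.1.1 : ℤ))
    rw [h1, h.mul_eq x.1.1 y.1.1, h.mul_eq x.1.2 y.1.2]
    simp only [map_add, map_sub, aug_intCast, ← fiber_aug]
    push_cast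
    ring

/-- The addition on a square-zero extension. -/
noncomputable def IsSqZero.add (h : IsSqZero Y) : fiberSq Y ⟶ Y :=
  overHomMk (Y := fiberSq Y) h.addRingHom
    (fun n (x : fiberSubring Y.hom Y.hom) => by
      have := congrArg (PowerSeries.coeff n) (h.lamT_add_sub (fiber_aug x))
      simp only [coeff_lamT, map_add, map_sub] at this
      change LambdaRing.lam n x.1.1 + LambdaRing.lam n x.1.2 -
        (aug Y (LambdaRing.lam n x.1.1) : ℤ) = LambdaRing.lam n (x.1.1 + x.1.2 - (aug Y x.1.1 : ℤ))
      rw [this, lam_intCast, aug_lam])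
    (fun (x : fiberSubring Y.hom Y.hom) => by
      change aug Y (x.1.1 + x.1.2 - (aug Y x.1.1 : ℤ)) = aug Y x.1.1
      simp [← fiber_aug])

/-- The negation `x ↦ 2 ε(x) - x` on a square-zero extension. -/
noncomputable def IsSqZero.neg (h : IsSqZero Y) : Y ⟶ Y :=
  overHomMk
    { toFun := fun x => (aug Y x : ℤ) + (aug Y x : ℤ) - x
      map_one' := by simp
      map_zero' := by simp
      map_add' := fun x y => by simp; ring
      map_mul' := fun x y => by
        rw [h.mul_eq x y, h.mul_eq ((aug Y x : ℤ) + (aug Y x : ℤ) - x)]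
        simp
        ring }
    (fun n x => by
      have := congrArg (PowerSeries.coeff n) (h.lamT_sub x)
      simp only [coeff_lamT, map_add, map_sub] at this
      change (aug Y (LambdaRing.lam n x) : ℤ) + (aug Y (LambdaRing.lam n x) : ℤ) - LambdaRing.lam n x =
        LambdaRing.lam n ((aug Y x : ℤ) + (aug Y x : ℤ) - x)
      rw [this, lam_intCast, aug_lam])
    (fun x => by
      change aug Y ((aug Y x : ℤ) + (aug Y x : ℤ) - x) = aug Y x
      simp)

/-- The unit section. -/
noncomputable def unitSection (Y : Over F1) : MonoidalCategoryStruct.tensorUnit (Over F1) ⟶ Y :=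
  overHomMk (Y := MonoidalCategoryStruct.tensorUnit (Over F1)) (Int.castRingHom Y.left)
    (fun n (k : ℤ) => (lam_intCast n k).symm) (fun (k : ℤ) => aug_intCast k)

open MonoidalCategory CartesianMonoidalCategory

/-- A square-zero extension of `F_1` is a group object. -/
noncomputable abbrev IsSqZero.grpObj (h : IsSqZero Y) : GrpObj Y where
  one := unitSection Y
  mul := h.add
  one_mul := over_hom_ext fun x => by
    -- The monoidal unit is `F1` itself, so an element of its product with `Y` is a pair `(ε(b),
    -- b)`.
    obtain ⟨⟨(a : ℤ), (b : Y.left)⟩, (hx : a = aug Y b)⟩ := x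
    change (a : Y.left) + b - (aug Y a : ℤ) = b
    rw [aug_intCast]
    ring
  mul_one := over_hom_ext fun x => by
    obtain ⟨⟨(b : Y.left), (a : ℤ)⟩, (hx : aug Y b = a)⟩ := x
    change b + (a : Y.left) - (aug Y b : ℤ) = b
    rw [hx]
    ring
  mul_assoc := over_hom_ext fun x => by
    obtain ⟨⟨⟨⟨(a : Y.left), (b : Y.left)⟩, (hab : aug Y a = aug Y b)⟩, (c : Y.left)⟩,
      (h2 : aug Y a = aug Y c)⟩ := x
    change (a + b - (aug Y a : ℤ)) + c - (aug Y (a + b - (aug Y a : ℤ)) : ℤ) =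
      a + (b + c - (aug Y b : ℤ)) - (aug Y a : ℤ)
    simp [← hab]
    ring
  inv := h.neg
  left_inv := over_hom_ext fun (x : Y.left) => by
    change (aug Y x : ℤ) + (aug Y x : ℤ) - x + x -
      (aug Y ((aug Y x : ℤ) + (aug Y x : ℤ) - x) : ℤ) = (aug Y x : Y.left)
    simp
  right_inv := over_hom_ext fun (x : Y.left) => by
    change x + ((aug Y x : ℤ) + (aug Y x : ℤ) - x) - (aug Y x : ℤ) = (aug Y x : Y.left)
    ring

/-- The `λ`-module of a square-zero extension. -/
noncomputable def IsSqZero.toMod (h : IsSqZero Y) : LambdaMod F1 :=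
  letI := h.grpObj
  { X := Y
    comm := ⟨over_hom_ext fun x => by
      obtain ⟨⟨(a : Y.left), (b : Y.left)⟩, (hx : aug Y a = aug Y b)⟩ := x
      change b + a - (aug Y b : ℤ) = a + b - (aug Y a : ℤ)
      rw [hx, add_comm]⟩ }

/-! ### Uniqueness of the group law, and morphisms of `λ`-modules. -/

/-- The group law of a `λ`-module over `F_1`. -/
noncomputable def mulMap (P : LambdaMod F1) : fiberSubring P.X.hom P.X.hom →+* P.X.left :=
  ringMap (MonObj.mul : P.X ⊗ P.X ⟶ P.X)

/-- The group law is a ring homomorphism on the fibre product. With `k` the common augmentation of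
`a` and `b`, one has `(a, b) = (a, k) + (k, b) - (k, k)`, and the unit laws give the values `a`, `b`
at the first two terms. -/
theorem mulMap_eq (P : LambdaMod F1) (x : fiberSubring P.X.hom P.X.hom) :
    mulMap P x = x.1.1 + x.1.2 - (aug P.X x.1.1 : ℤ) := by
  -- The unit section is a ring homomorphism out of `ℤ`, hence the integer cast.
  have hone : ∀ k : ℤ, ringMap (MonObj.one : 𝟙_ (Over F1) ⟶ P.X) k = (k : P.X.left) := fun k =>
    map_intCast (ringMap (MonObj.one : 𝟙_ (Over F1) ⟶ P.X)) k
  have h1 : ∀ a : P.X.left, mulMap P ⟨(((aug P.X a : ℤ) : P.X.left), a), aug_intCast _⟩ = a := by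
    intro a
    have : mulMap P ⟨(ringMap (MonObj.one : 𝟙_ (Over F1) ⟶ P.X) (aug P.X a), a),
        aug_ringMap (MonObj.one : 𝟙_ (Over F1) ⟶ P.X) (aug P.X a)⟩ = a :=
      RingHom.congr_fun (congrArg ringMap (MonObj.one_mul P.X))
        (⟨((aug P.X a : ℤ), a), rfl⟩ : fiberSubring (𝟙_ (Over F1)).hom P.X.hom)
    simpa only [hone] using this
  have h2 : ∀ a : P.X.left, mulMap P ⟨(a, ((aug P.X a : ℤ) : P.X.left)), (aug_intCast _).symm⟩ =
      a := by
    intro a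
    have : mulMap P ⟨(a, ringMap (MonObj.one : 𝟙_ (Over F1) ⟶ P.X) (aug P.X a)),
        (aug_ringMap (MonObj.one : 𝟙_ (Over F1) ⟶ P.X) (aug P.X a)).symm⟩ = a :=
      RingHom.congr_fun (congrArg ringMap (MonObj.mul_one P.X))
        (⟨(a, (aug P.X a : ℤ)), rfl⟩ : fiberSubring P.X.hom (𝟙_ (Over F1)).hom)
    simpa only [hone] using this
  obtain ⟨⟨a, b⟩, hab⟩ := x
  have hab' : aug P.X a = aug P.X b := hab
  have h3 : (⟨(a, b), hab⟩ : fiberSubring P.X.hom P.X.hom) =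
      ⟨(a, ((aug P.X a : ℤ) : P.X.left)), (aug_intCast _).symm⟩ +
        ⟨(((aug P.X b : ℤ) : P.X.left), b), aug_intCast _⟩ - ((aug P.X a : ℤ) : _) :=
    Subtype.ext (Prod.ext (by simp [hab']) (by simp))
  rw [h3, map_sub, map_add, h1, h2, map_intCast]
  simp [hab']

/-- In the fibre product `(x, 0) * (0, y) = 0`, while the group law, a ring homomorphism, sends the
two factors to `x` and `y`. -/
theorem isSqZero_mod (P : LambdaMod F1) : IsSqZero P.X := by
  intro x y hx hy
  have h1 := map_mul (mulMap P) ⟨(x, 0), hx.trans (map_zero (aug P.X)).symm⟩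
    ⟨(0, y), (map_zero (aug P.X)).trans hy.symm⟩
  simpa [mulMap_eq, hx] using h1.symm

theorem one_eq (P : LambdaMod F1) (k : 𝟙_ (Over F1) |>.left) :
    ringMap (MonObj.one : 𝟙_ (Over F1) ⟶ P.X) k = ((show ℤ from k : ℤ) : P.X.left) :=
  map_intCast (ringMap (MonObj.one : 𝟙_ (Over F1) ⟶ P.X)) (show ℤ from k)

/-- Every morphism over `F_1` between `λ`-modules respects the group structures. -/
theorem isMonHom_mod {P Q : LambdaMod F1} (f : P.X ⟶ Q.X) : IsMonHom f where
  one_hom := over_hom_ext fun k => by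
    rw [ringMap_comp, one_eq, one_eq, map_intCast]
  mul_hom := over_hom_ext fun (x : fiberSubring P.X.hom P.X.hom) => by
    obtain ⟨⟨a, b⟩, hab⟩ := x
    -- Both group laws are `a + b - ε(a)`, an expression preserved by any ring homomorphism
    -- compatible with the augmentations.
    refine (congrArg (ringMap f) (mulMap_eq P ⟨(a, b), hab⟩)).trans (Eq.trans ?_ (mulMap_eq Q
      ⟨(ringMap f a, ringMap f b), by
        exact (aug_ringMap f a).trans (Eq.trans hab (aug_ringMap f b).symm)⟩).symm)
    simp [aug_ringMap]

/-- The category of `λ`-modules over `F_1` is a full subcategory of the `λ`-rings over `F_1`. -/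
noncomputable def modHom {P Q : LambdaMod F1} (f : P.X ⟶ Q.X) : P ⟶ Q :=
  haveI := isMonHom_mod f
  InducedCategory.homMk (Grp.homMk f)

/-- The underlying ring homomorphism of a morphism of `λ`-modules. -/
noncomputable def modMap {P Q : LambdaMod F1} (f : P ⟶ Q) : P.X.left →+* Q.X.left :=
  ringMap f.hom.hom.hom

@[simp]
theorem modMap_modHom {P Q : LambdaMod F1} (f : P.X ⟶ Q.X) (x : P.X.left) :
    modMap (modHom f) x = ringMap f x := rfl

@[simp]
theorem modMap_comp {P Q R : LambdaMod F1} (f : P ⟶ Q) (g : Q ⟶ R) (x : P.X.left) :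
    modMap (f ≫ g) x = modMap g (modMap f x) := rfl

theorem mod_hom_ext {P Q : LambdaMod F1} {f g : P ⟶ Q} (h : ∀ x, modMap f x = modMap g x) :
    f = g :=
  CommGrp.hom_ext _ _ (over_hom_ext h)

theorem aug_modMap {P Q : LambdaMod F1} (f : P ⟶ Q) (x : P.X.left) :
    aug Q.X (modMap f x) = aug P.X x := aug_ringMap _ x

theorem modMap_lam {P Q : LambdaMod F1} (f : P ⟶ Q) (n : ℕ) (x : P.X.left) :
    modMap f (LambdaRing.lam n x) = LambdaRing.lam n (modMap f x) := ringMap_lam _ n x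

/-- The zero morphism of `λ`-modules. -/
noncomputable def zeroHom (P Q : LambdaMod F1) : P ⟶ Q :=
  modHom (overHomMk ((Int.castRingHom Q.X.left).comp (aug P.X))
    (fun n x => by simp [aug_lam, lam_intCast]) (fun x => by simp))

@[simp]
theorem modMap_zeroHom (P Q : LambdaMod F1) (x : P.X.left) :
    modMap (zeroHom P Q) x = (aug P.X x : ℤ) := rfl

/-- Ring homomorphisms fix integers, which settles maps out of `Z`; a map into `Z` is determined by
the augmentation, which it preserves. -/
theorem isZero_of_forall {Z : LambdaMod F1} (h : ∀ z : Z.X.left, z = (aug Z.X z : ℤ)) :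
    IsZero Z where
  unique_to Q := ⟨⟨⟨zeroHom Z Q⟩, fun f => mod_hom_ext fun z => by
    rw [h z]
    simp⟩⟩
  unique_from Q := ⟨⟨⟨zeroHom Q Z⟩, fun f => mod_hom_ext fun z => by
    rw [h (modMap f z), aug_modMap]
    rfl⟩⟩

theorem isZero_trivial : IsZero (CommGrp.trivial (Over F1)) :=
  isZero_of_forall fun z => (Int.cast_id (n := z)).symm

/-- A map to a zero object must equal `zeroHom`, whose values are integers, and these are fixed by
what follows. Conversely such an `f` factors through the trivial group `F_1`. -/
theorem isZeroMorphism_iff {P Q : LambdaMod F1} (f : P ⟶ Q) :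
    IsZeroMorphism f ↔ ∀ x, modMap f x = (aug P.X x : ℤ) := by
  constructor
  · rintro ⟨Z, a, b, hZ, rfl⟩ x
    have : a = zeroHom P Z := hZ.eq_of_tgt _ _
    subst this
    simp
  · intro h
    refine ⟨_, zeroHom P _, zeroHom _ Q, isZero_trivial, mod_hom_ext fun x => ?_⟩
    simp [h]

/-- Parallel morphisms preserve augmentations, so their values differ by elements of the
augmentation ideal; only the kernel there matters. -/
theorem mono_of_injective {P Q : LambdaMod F1} (f : P ⟶ Q)
    (h : ∀ x, aug P.X x = 0 → modMap f x = 0 → x = 0) : Mono f where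
  right_cancellation {R} g k hgk := mod_hom_ext fun x => by
    rw [← sub_eq_zero]
    apply h
    · simp [aug_modMap]
    · rw [map_sub, ← modMap_comp, ← modMap_comp, hgk, sub_self]

/-- A bijective morphism of `λ`-modules is an isomorphism. -/
theorem nonempty_iso_of_bijective {P Q : LambdaMod F1} (f : P ⟶ Q)
    (h : Function.Bijective (modMap f)) : Nonempty (P ≅ Q) := by
  let e := RingEquiv.ofBijective (modMap f) h
  have he : ∀ x, modMap f (e.symm x) = x := e.apply_symm_apply
  let g : Q ⟶ P := modHom (overHomMk (e.symm : Q.X.left →+* P.X.left)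
    (fun n x => h.1 (by
      rw [modMap_lam]
      exact (he _).trans (congrArg _ (he x).symm)))
    (fun x => by
      rw [← aug_modMap f]
      exact congrArg _ (he x)))
  exact ⟨⟨f, g, mod_hom_ext fun x => e.symm_apply_apply x, mod_hom_ext fun x => he x⟩⟩

end OverF1
end FOne

namespace FOne

/-! ### The extensions `ℤ ⊕ ℤ/n` as quotients of the affine line. -/

section Cyclic

open Polynomial

/-- The square-zero extension of `ℤ` by the abelian group `ℤ/n`. -/
@[ext]
structure SqExt (n : ℕ) where
  /-- The integer part. -/
  fst : ℤ
  /-- The nilpotent part. -/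
  snd : ZMod n

namespace SqExt

variable {n : ℕ}

instance : Zero (SqExt n) := ⟨⟨0, 0⟩⟩
instance : One (SqExt n) := ⟨⟨1, 0⟩⟩
instance : Add (SqExt n) := ⟨fun x y => ⟨x.fst + y.fst, x.snd + y.snd⟩⟩
instance : Neg (SqExt n) := ⟨fun x => ⟨-x.fst, -x.snd⟩⟩
instance : Mul (SqExt n) := ⟨fun x y => ⟨x.fst * y.fst, x.fst * y.snd + y.fst * x.snd⟩⟩

@[simp] theorem zero_fst : (0 : SqExt n).fst = 0 := rfl
@[simp] theorem zero_snd : (0 : SqExt n).snd = 0 := rfl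
@[simp] theorem one_fst : (1 : SqExt n).fst = 1 := rfl
@[simp] theorem one_snd : (1 : SqExt n).snd = 0 := rfl
@[simp] theorem add_fst (x y : SqExt n) : (x + y).fst = x.fst + y.fst := rfl
@[simp] theorem add_snd (x y : SqExt n) : (x + y).snd = x.snd + y.snd := rfl
@[simp] theorem neg_fst (x : SqExt n) : (-x).fst = -x.fst := rfl
@[simp] theorem neg_snd (x : SqExt n) : (-x).snd = -x.snd := rfl
@[simp] theorem mul_fst (x y : SqExt n) : (x * y).fst = x.fst * y.fst := rfl
@[simp] theorem mul_snd (x y : SqExt n) :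
    (x * y).snd = x.fst * y.snd + y.fst * x.snd := rfl

instance : CommRing (SqExt n) where
  add_assoc x y z := by ext <;> simp [add_assoc]
  zero_add x := by ext <;> simp
  add_zero x := by ext <;> simp
  add_comm x y := by ext <;> simp [add_comm]
  neg_add_cancel x := by ext <;> simp
  left_distrib x y z := by ext <;> simp <;> ring
  right_distrib x y z := by ext <;> simp <;> ring
  zero_mul x := by ext <;> simp
  mul_zero x := by ext <;> simp
  mul_assoc x y z := by ext <;> simp <;> ring
  one_mul x := by ext <;> simp
  mul_one x := by ext <;> simp
  mul_comm x y := by ext <;> simp <;> ring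
  nsmul := nsmulRec
  zsmul := zsmulRec

/-- The projection to the integer part. -/
def fstHom (n : ℕ) : SqExt n →+* ℤ where
  toFun := fst
  map_one' := rfl
  map_zero' := rfl
  map_add' _ _ := rfl
  map_mul' _ _ := rfl

@[simp] theorem fstHom_apply (x : SqExt n) : fstHom n x = x.fst := rfl

@[simp] theorem intCast_fst (k : ℤ) : (k : SqExt n).fst = k := by
  rw [← fstHom_apply, map_intCast, Int.cast_id]

/-- The inclusion of the nilpotent part. -/
def inr (n : ℕ) : ZMod n →+ SqExt n where
  toFun j := ⟨0, j⟩
  map_zero' := rfl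
  map_add' _ _ := by ext <;> simp

theorem inr_apply (j : ZMod n) : inr n j = ⟨0, j⟩ := rfl

/-- The nilpotent part, as an additive map. -/
def sndHom (n : ℕ) : SqExt n →+ ZMod n where
  toFun := snd
  map_zero' := rfl
  map_add' _ _ := rfl

@[simp] theorem sndHom_apply (x : SqExt n) : sndHom n x = x.snd := rfl

@[simp] theorem intCast_snd (k : ℤ) : (k : SqExt n).snd = 0 := by
  have : sndHom n ((k : ℤ) • (1 : SqExt n)) = 0 := by rw [map_zsmul]; simp
  simpa using this

/-- Reduction of polynomials modulo `X ^ 2` and `n X`. -/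
def proj (n : ℕ) : ℤ[X] →+* SqExt n where
  toFun f := ⟨f.coeff 0, (f.coeff 1 : ℤ)⟩
  map_one' := by ext <;> simp [coeff_one]
  map_zero' := by ext <;> simp
  map_add' f g := by ext <;> simp
  map_mul' f g := by ext <;> simp [mul_coeff_zero, mul_coeff_one]; ring

@[simp] theorem proj_fst (f : ℤ[X]) : (proj n f).fst = f.coeff 0 := rfl
@[simp] theorem proj_snd (f : ℤ[X]) : (proj n f).snd = (f.coeff 1 : ℤ) := rfl

theorem proj_surjective : Function.Surjective (proj n) := by
  rintro ⟨a, j⟩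
  obtain ⟨b, rfl⟩ := ZMod.intCast_surjective j
  exact ⟨C a + C b * X, by ext <;> simp⟩

theorem proj_X_pow {k : ℕ} (hk : 2 ≤ k) : proj n (X ^ k) = 0 := by
  ext
  · rw [proj_fst, coeff_X_pow, if_neg (by omega), zero_fst]
  · rw [proj_snd, coeff_X_pow, if_neg (by omega), zero_snd, Int.cast_zero]

/-- The operations `λ^k(a, j) = (binom(a, k), binom(a, k - 1) j)`. -/
def lam : ℕ → SqExt n → SqExt n
  | 0, _ => 1
  | k + 1, x => ⟨Ring.choose x.fst (k + 1), (Ring.choose x.fst k : ℤ) * x.snd⟩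

/-- Modulo `X ^ 2` the factors of `∏ (1 + X ^ i t) ^ {a_i}` with `i ≥ 2` become `1`, and the factor
with `i = 1` becomes `1 + a_1 X t`. Multiplying by `(1 + t) ^ {a_0}` gives the coefficients
`binom(a_0, k) + binom(a_0, k - 1) a_1 X` for `k ≥ 1`. -/
theorem proj_lam (k : ℕ) (f : ℤ[X]) : proj n (LambdaRing.lam k f) = lam k (proj n f) := by
  change proj n (PowerSeries.coeff k (lamSeries f)) = _
  -- The indices `0` and `1` are always included, so that their factors can be split off; a zero
  -- coefficient contributes a trivial factor.
  have hs : f.support ⊆ insert 0 (insert 1 (f.support.filter fun i => 2 ≤ i)) := by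
    intro i hi
    rcases i with _ | _ | i
    · simp
    · simp
    · simp [mem_support_iff.1 hi]
  rw [← PowerSeries.coeff_map, lamSeries_eq hs, map_prod, Finset.prod_insert (by simp),
    Finset.prod_insert (by simp), Finset.prod_eq_one, mul_one]
  · have h1 : PowerSeries.map (proj n)
        (PowerSeries.mk fun k => C (Ring.choose (f.coeff 1) k) * (X ^ 1) ^ k) =
        1 + PowerSeries.C (inr n (f.coeff 1 : ℤ)) * PowerSeries.X := by
      ext1 k
      rw [PowerSeries.coeff_map, PowerSeries.coeff_mk]
      rcases k with _ | _ | k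
      · simp
      · ext <;> simp [PowerSeries.coeff_one, inr_apply]
      · rw [pow_one, map_mul, proj_X_pow (by omega), mul_zero]
        simp [PowerSeries.coeff_one]
    rw [h1, mul_add, mul_one, map_add, mul_comm, mul_assoc]
    rcases k with _ | k
    · simp [lam]
    · rw [PowerSeries.coeff_C_mul, PowerSeries.coeff_succ_X_mul]
      simp only [PowerSeries.coeff_map, PowerSeries.coeff_mk]
      ext <;> simp [lam, inr_apply]
  · intro i hi
    obtain ⟨i, rfl⟩ : ∃ j, i = j + 2 := ⟨i - 2, by simp at hi; omega⟩
    ext1 k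
    rw [PowerSeries.coeff_map, PowerSeries.coeff_mk, PowerSeries.coeff_one]
    rcases k with _ | k
    · simp
    · rw [← pow_mul, map_mul, proj_X_pow (by nlinarith), mul_zero, if_neg (by omega)]

/-- The universal identities are inherited from `ℤ[x]` through the surjection `proj n`. -/
noncomputable instance : LambdaRing (SqExt n) :=
  LambdaRing.ofSurjective (proj n) proj_surjective lam proj_lam

theorem fstHom_lam (k : ℕ) (x : SqExt n) :
    fstHom n (LambdaRing.lam k x) = LambdaRing.lam k (fstHom n x) := by
  change (lam k x).fst = Ring.choose x.fst k
  rcases k with _ | k <;> simp [lam]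

end SqExt

/-- The extension of `F_1` by `ℤ/n`, as an object over `F_1`. -/
noncomputable def sqOver (n : ℕ) : Over F1 :=
  Over.mk (Y := (⟨SqExt n⟩ : LambdaRingCat))
    (⟨SqExt.fstHom n, SqExt.fstHom_lam⟩ : LambdaHom (SqExt n) ℤ)

theorem isSqZero_sqOver (n : ℕ) : IsSqZero (sqOver n) := by
  intro (x : SqExt n) (y : SqExt n) (hx : x.fst = 0) (hy : y.fst = 0)
  change (x * y : SqExt n) = 0
  exact SqExt.ext (by simp [hx]) (by simp [hx, hy])

/-- The `λ`-module `ℤ/n` on which all `λ^k` with `k > 1` vanish. -/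
noncomputable def cyclicMod (n : ℕ) : LambdaMod F1 := (isSqZero_sqOver n).toMod

/-- The morphism from the affine line to `ℤ/n` given by the element `1`. -/
noncomputable def lineProj (n : ℕ) : affineLine ⟶ sqOver n :=
  overHomMk (Y := affineLine) (Z := sqOver n) (SqExt.proj n) (fun k f => SqExt.proj_lam k f)
    (fun (f : ℤ[X]) => coeff_zero_eq_eval_zero f)

/-- Multiplication by `c` on `ℤ/n`. -/
noncomputable def scaleHom (n : ℕ) (c : ZMod n) : cyclicMod n ⟶ cyclicMod n :=
  modHom (P := cyclicMod n) (Q := cyclicMod n) (overHomMk (Y := sqOver n) (Z := sqOver n)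
    ({ toFun := fun x => ⟨x.fst, c * x.snd⟩
       map_one' := by ext <;> simp
       map_zero' := by ext <;> simp
       map_add' := fun x y => by ext <;> simp; ring
       map_mul' := fun x y => by ext <;> simp; ring } : SqExt n →+* SqExt n)
    (fun k (x : SqExt n) => by
      change (⟨(SqExt.lam k x).fst, c * (SqExt.lam k x).snd⟩ : SqExt n) =
        SqExt.lam k ⟨x.fst, c * x.snd⟩
      rcases k with _ | k
      · ext <;> simp [SqExt.lam]
      · ext <;> simp [SqExt.lam]; ring)
    (fun _ => rfl))

/-- The coordinate of the affine line. -/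
noncomputable def lineX : affineLine.left := (X : ℤ[X])

theorem line_hom_ext {Y : Over F1} {f g : affineLine ⟶ Y}
    (h : ringMap f lineX = ringMap g lineX) : f = g := by
  apply over_hom_ext
  have : (show ℤ[X] →+* Y.left from ringMap f) = ringMap g :=
    Polynomial.ringHom_ext' (RingHom.ext_int _ _) h
  exact RingHom.congr_fun this

theorem aug_lineX : aug affineLine lineX = 0 := eval_X

theorem lam_lineX {n : ℕ} (hn : 2 ≤ n) : LambdaRing.lam n lineX = 0 := by
  change PowerSeries.coeff n (lamSeries X) = 0
  have := lamSeries_X_pow 1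
  rw [pow_one] at this
  obtain ⟨k, rfl⟩ : ∃ k, n = k + 2 := ⟨n - 2, by omega⟩
  rw [this]
  simp [PowerSeries.coeff_one]

/-- The image of `X` lies in the augmentation ideal, so its square is zero and only the constant and
linear terms of `p` survive. -/
theorem ringMap_line {Y : Over F1} (h : IsSqZero Y) (f : affineLine ⟶ Y) (p : ℤ[X]) :
    ringMap f p = (p.coeff 0 : Y.left) + (p.coeff 1 : Y.left) * ringMap f lineX := by
  let φ : ℤ[X] →+* Y.left := ringMap f
  have hx : aug Y (φ X) = 0 := (aug_ringMap f lineX).trans aug_lineX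
  have hC : ∀ k : ℤ, φ (C k) = k := fun k => by
    rw [show (C k : ℤ[X]) = (k : ℤ[X]) by simp, map_intCast]
  have h1 : p = (p.divX.divX * X + C (p.coeff 1)) * X + C (p.coeff 0) := by
    conv_lhs => rw [← divX_mul_X_add p, ← divX_mul_X_add p.divX, coeff_divX]
  have h2 := h _ _ hx hx
  change φ p = (p.coeff 0 : Y.left) + (p.coeff 1 : Y.left) * φ X
  conv_lhs => rw [h1]
  simp only [map_add, map_mul, hC]
  linear_combination φ p.divX.divX * h2

/-- The morphism `ℤ/n → P` given by an element of `P` that is killed by `n` and by all `λ^k` with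
`k > 1`. -/
theorem exists_cyclic_hom {n : ℕ} (P : LambdaMod F1) (f : affineLine ⟶ P.X)
    (hn : (n : P.X.left) * ringMap f lineX = 0) :
    ∃ g : cyclicMod n ⟶ P, ∀ p : ℤ[X], modMap g (SqExt.proj n p) = ringMap f p := by
  let ψ : ℤ[X] →+* P.X.left := ringMap f
  -- The kernel of `proj n` consists of the `p` with constant term `0` and linear coefficient
  -- divisible by `n`; since `n` kills the image of `X`, `ringMap_line` shows that `ψ` kills them.
  have hker : RingHom.ker (SqExt.proj n) ≤ RingHom.ker ψ := by
    intro p hp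
    rw [RingHom.mem_ker] at hp ⊢
    have h0 : p.coeff 0 = 0 := congrArg SqExt.fst hp
    have h1 : ((p.coeff 1 : ℤ) : ZMod n) = 0 := congrArg SqExt.snd hp
    obtain ⟨c, hc⟩ := (ZMod.intCast_zmod_eq_zero_iff_dvd _ n).1 h1
    refine (ringMap_line (isSqZero_mod P) f p).trans ?_
    rw [h0, hc]
    push_cast
    linear_combination (c : P.X.left) * hn
  let φ := (SqExt.proj n).liftOfSurjective SqExt.proj_surjective ⟨ψ, hker⟩
  have hφ : ∀ p, φ (SqExt.proj n p) = ringMap f p := fun p =>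
    RingHom.liftOfRightInverse_comp_apply _ _ _ ⟨ψ, hker⟩ p
  refine ⟨modHom (P := cyclicMod n) (overHomMk (Y := sqOver n) φ ?_ ?_), hφ⟩
  · intro k (x : SqExt n)
    obtain ⟨p, rfl⟩ := SqExt.proj_surjective x
    have h1 : LambdaRing.lam k (SqExt.proj n p) = SqExt.proj n (LambdaRing.lam k p) :=
      (SqExt.proj_lam k p).symm
    exact (congrArg φ h1).trans ((hφ _).trans ((ringMap_lam f k p).trans
      (congrArg (LambdaRing.lam k) (hφ p).symm)))
  · intro (x : SqExt n)
    obtain ⟨p, rfl⟩ := SqExt.proj_surjective x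
    refine (congrArg _ (hφ p)).trans ((aug_ringMap f p).trans ?_)
    exact (coeff_zero_eq_eval_zero p).symm

end Cyclic
end FOne

namespace FOne

/-! ### Quotients of `λ`-rings, and primitive elements. -/

section Quotient

variable {R : Type*} [CommRing R] [LambdaRing R]

/-- The operations on a quotient of a `λ`-ring, computed on representatives. -/
noncomputable def quotientLam (I : Ideal R) (n : ℕ) (y : R ⧸ I) : R ⧸ I :=
  Ideal.Quotient.mk I
    (LambdaRing.lam n (Function.surjInv (Ideal.Quotient.mk_surjective (I := I)) y))

/-- By `hI` the class of `λ^n` is constant on cosets of `I`, so the representative chosen in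
`quotientLam` is immaterial. -/
theorem mk_lam {I : Ideal R}
    (hI : ∀ n x, ∀ u ∈ I, LambdaRing.lam n (x + u) - LambdaRing.lam n x ∈ I) (n : ℕ) (x : R) :
    Ideal.Quotient.mk I (LambdaRing.lam n x) = quotientLam I n (Ideal.Quotient.mk I x) := by
  have h := Function.surjInv_eq (Ideal.Quotient.mk_surjective (I := I)) (Ideal.Quotient.mk I x)
  rw [quotientLam]
  generalize Function.surjInv _ (Ideal.Quotient.mk I x) = z at h ⊢
  have h1 := hI n z _ (Ideal.Quotient.eq.1 h.symm)
  rw [add_sub_cancel] at h1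
  exact Ideal.Quotient.eq.2 h1

/-- The quotient of a `λ`-ring by an ideal compatible with the operations. -/
noncomputable abbrev LambdaRing.quotient (I : Ideal R)
    (hI : ∀ n x, ∀ u ∈ I, LambdaRing.lam n (x + u) - LambdaRing.lam n x ∈ I) :
    LambdaRing (R ⧸ I) :=
  LambdaRing.ofSurjective (Ideal.Quotient.mk I) Ideal.Quotient.mk_surjective
    (quotientLam I) (mk_lam hI)

variable {Y : Over F1}

/-- The elements of the augmentation ideal that are killed by `λ^n` for `n > 1`. -/
def IsSqZero.primitives (h : IsSqZero Y) : AddSubgroup Y.left where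
  carrier := {x | aug Y x = 0 ∧ lamT x = 1 + PowerSeries.C x * PowerSeries.X}
  zero_mem' := ⟨map_zero _, by simp [lamT_zero]⟩
  add_mem' := fun {x y} hx hy => ⟨by simp [hx.1, hy.1], by
    rw [h.lamT_add hx.1 hy.1, hx.2, hy.2, map_add]
    ring⟩
  neg_mem' := fun {x} hx => ⟨by simp [hx.1], by
    rw [h.lamT_neg hx.1, hx.2, map_neg]
    ring⟩

/-- The coordinate satisfies `λ_t(x) = 1 + x t` and has augmentation `0`; morphisms preserve both
properties. -/
theorem lineX_mem_primitives (h : IsSqZero Y) (f : affineLine ⟶ Y) :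
    ringMap f lineX ∈ h.primitives := by
  refine ⟨(aug_ringMap f lineX).trans aug_lineX, ?_⟩
  ext1 n
  rw [coeff_lamT]
  rcases n with _ | _ | n
  · simp [LambdaRing.lam_zero]
  · simp [LambdaRing.lam_one, PowerSeries.coeff_one]
  · rw [← ringMap_lam, lam_lineX (by omega), map_zero]
    simp [PowerSeries.coeff_one]

/-- The subgroup generated by a primitive element is the kernel of a surjection of
`λ`-modules. -/
theorem exists_quotient (P : LambdaMod F1) {m : P.X.left}
    (hm : m ∈ (isSqZero_mod P).primitives) :
    ∃ (Q : LambdaMod F1) (q : P ⟶ Q), ∀ x, modMap q x = 0 ↔ ∃ j : ℤ, x = j * m := by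
  have hsq := isSqZero_mod P
  let I : Ideal P.X.left := Ideal.span {m}
  -- Since `m` lies in an ideal of square zero, `a * m = ε(a) * m`, so the ideal generated by `m` is
  -- just the subgroup generated by `m`.
  have hI : ∀ x, x ∈ I ↔ ∃ j : ℤ, x = j * m := by
    intro x
    rw [Ideal.mem_span_singleton']
    constructor
    · rintro ⟨a, rfl⟩
      exact ⟨aug P.X a, by rw [hsq.mul_eq a m, hm.1]; simp⟩
    · rintro ⟨j, rfl⟩
      exact ⟨j, rfl⟩
  -- Elements `u` of `I` are again primitive, so `λ_t(x + u) = λ_t(x) (1 + u t)`, which differs from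
  -- `λ_t(x)` by a multiple of `u`.
  have hlam : ∀ n x, ∀ u ∈ I, LambdaRing.lam n (x + u) - LambdaRing.lam n x ∈ I := by
    intro n x u hu
    have hup : u ∈ hsq.primitives := by
      obtain ⟨j, rfl⟩ := (hI u).1 hu
      rw [← zsmul_eq_mul]
      exact AddSubgroup.zsmul_mem _ hm j
    have : LambdaRing.lam n (x + u) - LambdaRing.lam n x =
        u * PowerSeries.coeff n (lamT x * PowerSeries.X) := by
      rw [← coeff_lamT, ← coeff_lamT, lamT_add, hup.2, ← map_sub, ← PowerSeries.coeff_C_mul]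
      congr 1
      ring
    rw [this]
    exact I.mul_mem_right _ hu
  let := LambdaRing.quotient I hlam
  have haug : ∀ x ∈ I, aug P.X x = 0 := by
    intro x hx
    obtain ⟨j, rfl⟩ := (hI x).1 hx
    simp [hm.1]
  let ε : P.X.left ⧸ I →+* ℤ := Ideal.Quotient.lift I (aug P.X) haug
  let Y : Over F1 := Over.mk (Y := (⟨P.X.left ⧸ I⟩ : LambdaRingCat))
    (⟨ε, fun n => Ideal.Quotient.mk_surjective.forall.2 fun x =>
      (congrArg ε (mk_lam hlam n x)).symm.trans (aug_lam n x)⟩ :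
        LambdaHom (P.X.left ⧸ I) ℤ)
  let q : P.X ⟶ Y := overHomMk (Z := Y) (Ideal.Quotient.mk I) (mk_lam hlam)
    (fun _ => rfl)
  have hq : Function.Surjective (ringMap q) := Ideal.Quotient.mk_surjective
  have hY : IsSqZero Y := hq.forall₂.2 fun x y hx hy => by
    rw [aug_ringMap] at hx hy
    rw [← map_mul, hsq x y hx hy, map_zero]
  exact ⟨hY.toMod, modHom (Q := hY.toMod) q, fun x => Ideal.Quotient.eq_zero_iff_mem.trans (hI x)⟩

end Quotient

/-! ### Non-degenerate objects are the `ℤ/p`, and the Euler product. -/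

section Classification

/-- The generator of `ℤ/n`. -/
noncomputable def cyclicGen (n : ℕ) : (cyclicMod n).X.left := (⟨0, 1⟩ : SqExt n)

theorem lineProj_lineX (n : ℕ) : ringMap (lineProj n) lineX = cyclicGen n := by
  change SqExt.proj n Polynomial.X = ⟨0, 1⟩
  ext <;> simp

/-- The morphisms from the affine line to `ℤ/n` are the elements of `ℤ/n`. -/
noncomputable def lineHomEquiv (n : ℕ) : (affineLine ⟶ (cyclicMod n).X) ≃ ZMod n :=
  Equiv.ofBijective (fun f => SqExt.snd (n := n) (ringMap f lineX)) ⟨fun f g h => by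
    refine line_hom_ext (SqExt.ext (n := n) ?_ h)
    exact ((aug_ringMap f lineX).trans (aug_ringMap g lineX).symm), fun c => by
    refine ⟨lineProj n ≫ (scaleHom n c).hom.hom.hom, ?_⟩
    change SqExt.snd (n := n) (modMap (scaleHom n c) (ringMap (lineProj n) lineX)) = c
    rw [lineProj_lineX]
    exact mul_one c⟩

/-- The case `n = 0` is included: `ZMod 0` is infinite and `Nat.card` then takes the value `0`. This
is what later rules out generators of infinite order. -/
theorem geometricNorm_cyclicMod (n : ℕ) :
    geometricNorm (CommGrp.forget (Over F1)) affineLine (cyclicMod n) = n := by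
  refine (Nat.card_congr (lineHomEquiv n)).trans ?_
  exact Nat.card_zmod n

theorem modMap_cyclic_apply {n : ℕ} {Q : LambdaMod F1} (f : cyclicMod n ⟶ Q) (a b : ℤ) :
    modMap f (⟨a, b⟩ : SqExt n) = a + b * modMap f (cyclicGen n) := by
  have h : (⟨a, b⟩ : SqExt n) = (a : SqExt n) + (b : SqExt n) * ⟨0, 1⟩ := by ext <;> simp
  refine (congrArg (modMap f) h).trans ?_
  have h2 := map_add (modMap f) (a : (cyclicMod n).X.left) ((b : (cyclicMod n).X.left) * cyclicGen n)
  rw [map_mul, map_intCast, map_intCast] at h2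
  exact h2

theorem modMap_cyclic_gen_mul {n : ℕ} {Q : LambdaMod F1} (f : cyclicMod n ⟶ Q) :
    (n : Q.X.left) * modMap f (cyclicGen n) = 0 := by
  have := modMap_cyclic_apply f 0 n
  rw [Int.cast_natCast, ZMod.natCast_self] at this
  simpa using this.symm.trans (map_zero (modMap f))

/-- A morphism `f` is determined by the image of the generator, which is killed by `p`. If the image
is zero, so is `f`; otherwise it has order exactly `p`, and `f` is injective on the augmentation
ideal. -/
theorem isSimpleObject_cyclicMod {p : ℕ} (hp : p.Prime) : IsSimpleObject (cyclicMod p) := by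
  intro Q f
  by_cases h : modMap f (cyclicGen p) = 0
  · right
    rw [isZeroMorphism_iff]
    rintro ⟨a, j⟩
    obtain ⟨b, rfl⟩ := ZMod.intCast_surjective j
    refine (modMap_cyclic_apply f a b).trans ?_
    rw [h, mul_zero, add_zero]
    rfl
  · left
    refine mono_of_injective f ?_
    rintro ⟨a, j⟩ (rfl : a = 0) hx
    obtain ⟨b, rfl⟩ := ZMod.intCast_surjective j
    have h1 := (modMap_cyclic_apply f 0 b).symm.trans hx
    rw [Int.cast_zero, zero_add] at h1
    have h2 := modMap_cyclic_gen_mul f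
    have hb : (p : ℤ) ∣ b := by
      by_contra hb
      -- Bézout: the image of the generator is killed by both `p` and `b`, hence by `u * p + v * b =
      -- 1`.
      obtain ⟨u, v, huv⟩ := (((Nat.prime_iff_prime_int.1 hp).coprime_iff_not_dvd).2 hb)
      apply h
      have h3 := congrArg (Int.cast : ℤ → Q.X.left) huv
      push_cast at h3
      linear_combination -modMap f (cyclicGen p) * h3 + u * h2 + v * h1
    rw [(ZMod.intCast_zmod_eq_zero_iff_dvd b p).2 hb]
    rfl

theorem isNondegenerate_cyclicMod {p : ℕ} (hp : p.Prime) :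
    IsNondegenerate (CommGrp.forget (Over F1)) affineLine (cyclicMod p) := by
  have : NeZero p := ⟨hp.ne_zero⟩
  have hfin : Finite (affineLine ⟶ (cyclicMod p).X) := Finite.of_equiv _ (lineHomEquiv p).symm
  refine ⟨isSimpleObject_cyclicMod hp, ?_, hfin, ?_⟩
  -- As `SqExt.proj` is surjective, composition with `lineProj` embeds the endomorphisms into the
  -- finite set of morphisms from the line.
  · refine Finite.of_injective (β := affineLine ⟶ (cyclicMod p).X)
      (fun f => lineProj p ≫ f.hom.hom.hom) fun f g h => mod_hom_ext fun x => ?_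
    obtain ⟨y, rfl⟩ := SqExt.proj_surjective x
    exact RingHom.congr_fun (congrArg ringMap h) y
  · rw [geometricNorm_cyclicMod]
    exact hp.one_lt

/-- Let `n` divide `a * b` and apply simplicity to multiplication by `a`. If it is mono, its
composite with multiplication by `b` being zero forces `n ∣ b`; if it is zero, its value at the
generator gives `n ∣ a`. -/
theorem prime_of_isSimpleObject {n : ℕ} (hn0 : n ≠ 0) (hn1 : n ≠ 1)
    (h : IsSimpleObject (cyclicMod n)) : n.Prime := by
  rw [Nat.prime_iff]
  refine ⟨hn0, by simpa using hn1, fun a b hab => ?_⟩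
  rcases h _ (scaleHom n a) with hm | hz
  · right
    have h1 : scaleHom n b ≫ scaleHom n a = scaleHom n 0 ≫ scaleHom n a := by
      apply mod_hom_ext
      intro (x : SqExt n)
      change (⟨x.fst, a * (b * x.snd)⟩ : SqExt n) = ⟨x.fst, a * (0 * x.snd)⟩
      rw [← mul_assoc, ← Nat.cast_mul, (ZMod.natCast_eq_zero_iff _ _).2 hab]
      simp
    have h2 := congrArg (fun f => SqExt.snd (n := n) (modMap f (cyclicGen n)))
      ((cancel_mono _).1 h1)
    have h3 : (b : ZMod n) * 1 = 0 * 1 := h2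
    rw [← ZMod.natCast_eq_zero_iff]
    simpa using h3
  · left
    have h2 := congrArg (SqExt.snd (n := n)) ((isZeroMorphism_iff _).1 hz (cyclicGen n))
    have h3 : (a : ZMod n) * 1 = SqExt.snd ((0 : ℤ) : SqExt n) := h2
    rw [← ZMod.natCast_eq_zero_iff]
    simpa using h3

theorem IsSimpleObject.of_iso {C : Type*} [Category C] {P Q : C} (e : P ≅ Q)
    (h : IsSimpleObject P) : IsSimpleObject Q := by
  intro Y f
  rcases h Y (e.hom ≫ f) with hm | ⟨Z, a, b, hZ, hab⟩
  · left
    rw [← e.inv_hom_id_assoc f]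
    infer_instance
  · right
    exact ⟨Z, e.inv ≫ a, b, hZ, by rw [Category.assoc, ← hab, e.inv_hom_id_assoc]⟩

theorem exists_iso_cyclicMod {P : LambdaMod F1}
    (h : IsNondegenerate (CommGrp.forget (Over F1)) affineLine P) :
    ∃ p : ℕ, p.Prime ∧ Nonempty (cyclicMod p ≅ P) := by
  have hsq := isSqZero_mod P
  -- If all morphisms sent the coordinate to `0` they would coincide, contradicting `1 < n(P)`.
  obtain ⟨f, hf⟩ : ∃ f : affineLine ⟶ P.X, ringMap f lineX ≠ 0 := by
    by_contra! hall
    have : Subsingleton (affineLine ⟶ (CommGrp.forget (Over F1)).obj P) :=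
      ⟨fun f g => line_hom_ext ((hall f).trans (hall g).symm)⟩
    have h1 := h.one_lt
    have h2 : geometricNorm (CommGrp.forget (Over F1)) affineLine P ≤ 1 :=
      Finite.card_le_one_iff_subsingleton.2 this
    omega
  have hm := lineX_mem_primitives hsq f
  set m := ringMap f lineX
  -- This is `0` when `m` has infinite order; that case is excluded at the end.
  set n := addOrderOf m
  have hnm : (n : P.X.left) * m = 0 := by
    rw [← nsmul_eq_mul]
    exact addOrderOf_nsmul_eq_zero m
  obtain ⟨g, hg⟩ := exists_cyclic_hom P f hnm
  have hgen : modMap g (cyclicGen n) = m :=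
    (congrArg (modMap g) (lineProj_lineX n)).symm.trans (hg Polynomial.X)
  obtain ⟨Q, q, hq⟩ := exists_quotient P hm
  have hzero : ∀ j : ZMod n, modMap q (modMap g (⟨0, j⟩ : SqExt n)) = 0 := by
    intro j
    obtain ⟨b, rfl⟩ := ZMod.intCast_surjective j
    rw [hq]
    exact ⟨b, by rw [modMap_cyclic_apply, hgen]; simp⟩
  have hsurj : ∀ x : P.X.left, aug P.X x = 0 → ∃ j : ℤ, x = j * m := by
    -- If `q` were mono, then `g` would be zero, because `q` kills `g` on the augmentation ideal;
    -- but `g` sends the generator to `m ≠ 0`. So `q` is zero and the whole augmentation ideal lies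
    -- in its kernel `ℤm`.
    rcases h.simple Q q with hmono | hz
    · exfalso
      have h1 : g ≫ q = zeroHom _ P ≫ q := by
        apply mod_hom_ext
        rintro ⟨a, j⟩
        have h2 : (⟨a, j⟩ : SqExt n) = (a : SqExt n) + ⟨0, j⟩ := by ext <;> simp
        have h3 : modMap (g ≫ q) (⟨a, j⟩ : SqExt n) =
            modMap (g ≫ q) (a : (cyclicMod n).X.left) + modMap (g ≫ q) (⟨0, j⟩ : SqExt n) :=
          (congrArg _ h2).trans (map_add (modMap (g ≫ q)) _ _)
        refine h3.trans ?_
        rw [modMap_comp g q (⟨0, j⟩ : SqExt n), hzero, add_zero, map_intCast]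
        exact (map_intCast (modMap q) a).symm
      have h2 := congrArg (fun f => modMap f (cyclicGen n)) ((cancel_mono _).1 h1)
      have h3 : m = ((0 : ℤ) : P.X.left) := hgen.symm.trans h2
      exact hf (h3.trans Int.cast_zero)
    · intro x hx
      rw [← hq, (isZeroMorphism_iff q).1 hz, hx, Int.cast_zero]
  have hbij : Function.Bijective (modMap g) := by
    constructor
    · rw [injective_iff_map_eq_zero]
      rintro ⟨a, j⟩ hx
      obtain ⟨b, rfl⟩ := ZMod.intCast_surjective j
      have ha : a = 0 := by
        have := aug_modMap g (⟨a, b⟩ : SqExt n)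
        rw [hx, map_zero] at this
        exact this.symm
      subst ha
      have h1 := (modMap_cyclic_apply g 0 b).symm.trans hx
      rw [hgen, Int.cast_zero, zero_add, ← zsmul_eq_mul, ← addOrderOf_dvd_iff_zsmul_eq_zero,
        ← ZMod.intCast_zmod_eq_zero_iff_dvd] at h1
      rw [h1]
      rfl
    · intro x
      obtain ⟨b, hb⟩ := hsurj _ (aug_sub x)
      refine ⟨(⟨aug P.X x, b⟩ : SqExt n), ?_⟩
      rw [modMap_cyclic_apply, hgen, ← hb]
      ring
  obtain ⟨e⟩ := nonempty_iso_of_bijective g hbij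
  refine ⟨n, prime_of_isSimpleObject ?_ ?_ (h.simple.of_iso e.symm), ⟨e⟩⟩
  -- An isomorphism with `cyclicMod 0` would give `n(P) = 0`.
  · intro h0
    have h1 := geometricNorm_eq_of_iso (CommGrp.forget (Over F1)) affineLine e
    rw [geometricNorm_cyclicMod] at h1
    have := h.one_lt
    omega
  · intro h1
    rw [h1, Nat.cast_one, one_mul] at hnm
    exact hf hnm

/-- The isomorphism classes of non-degenerate `λ`-modules over `F_1` correspond to the primes. -/
theorem bijective_primes :
    Function.Bijective (fun p : Nat.Primes =>
      (⟨Quotient.mk (isIsomorphicSetoid (LambdaMod F1)) (cyclicMod p), cyclicMod p,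
        isNondegenerate_cyclicMod p.2, rfl⟩ :
        nondegenerateClasses (CommGrp.forget (Over F1)) affineLine)) := by
  constructor
  · intro p q h
    -- The norm is an isomorphism invariant, and it recovers `p` from the class of `ℤ/p`.
    have h1 := congrArg (fun c => classNorm (CommGrp.forget (Over F1)) affineLine c.1) h
    have h2 : geometricNorm (CommGrp.forget (Over F1)) affineLine (cyclicMod p) =
      geometricNorm (CommGrp.forget (Over F1)) affineLine (cyclicMod q) := h1
    rw [geometricNorm_cyclicMod, geometricNorm_cyclicMod] at h2
    exact Subtype.ext h2
  · rintro ⟨_, P, hP, rfl⟩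
    obtain ⟨p, hp, he⟩ := exists_iso_cyclicMod hP
    exact ⟨⟨p, hp⟩, Subtype.ext (Quotient.sound he)⟩

/-- Reindexing by the primes turns the product into the Euler product of `ζ`. `HasProd` is a limit
over the finite sets of classes, so the convergence is unconditional. -/
theorem hasProd_geometricFactor (s : ℂ) (hs : 1 < s.re) :
    HasProd (geometricFactor (C := LambdaMod F1) (CommGrp.forget (Over F1)) affineLine s)
      (riemannZeta s) := by
  rw [← (Equiv.ofBijective _ bijective_primes).hasProd_iff]
  have h : geometricFactor (C := LambdaMod F1) (CommGrp.forget (Over F1)) affineLine s ∘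
      Equiv.ofBijective _ bijective_primes = fun p : Nat.Primes => (1 - (p : ℂ) ^ (-s))⁻¹ := by
    ext p
    change (1 - (geometricNorm (CommGrp.forget (Over F1)) affineLine (cyclicMod p) : ℂ) ^
      (-s))⁻¹ = _
    rw [geometricNorm_cyclicMod]
  rw [h]
  exact riemannZeta_eulerProduct_hasProd hs

end Classification

end FOne
/-- For `1 < Re s` the product defining the geometric zeta function of the category of `λ`-modules
over `F_1` converges, and its value is the Riemann zeta function. Here
`n(P) = |Hom(ℤ[x], P)|` is computed in the category of `λ`-rings over `F_1`. -/
theorem corollary4p5 (s : ℂ) (hs : 1 < s.re) :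
    Multipliable (FOne.geometricFactor (C := FOne.LambdaMod FOne.F1)
        (CommGrp.forget (Over FOne.F1)) FOne.affineLine s) ∧
      FOne.geometricZeta (C := FOne.LambdaMod FOne.F1)
        (CommGrp.forget (Over FOne.F1)) FOne.affineLine s = riemannZeta s :=
  have h := FOne.hasProd_geometricFactor s hs
  ⟨h.multipliable, h.tprod_eq⟩
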